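/- **Setting.** Let $\mathcal H_R$ be a complex separable Hilbert space with a strongly continuous unitary group $t\mapsto e^{-itH_R}$ with self-adjoint generator $H_R$. Let $\Omega_R\in\mathcal H_R$ be a unit vector with $H_R\Omega_R=0$, and let $\omega_R=|\Omega_R\rangle\langle\Omega_R|$. Let $\mathcal H_S$ be a finite-dimensional complex Hilbert space, let $H_S,W$ be self-adjoint operators on $\mathcal H_S$, and let $V$ be a bounded self-adjoint operator on $\mathcal H_R$ with $\operatorname{tr}(V\omega_R)=0$. On the trace class operators $\mathcal T(\mathcal H)$ of $\mathcal H=\mathcal H_S\otimes\mathcal H_R$, with the trace norm, put $P\rho=\operatorname{tr}_R(\rho)\otimes\omega_R$, $Q=1-P$, $$e^{-itL_0}\rho=e^{-itH_0}\rho\, e^{itH_0},\quad H_0=H_S\otimes 1+1\otimes H_R,\qquad L_{SR}\rho=[W\otimes V,\rho],\qquad L_{SR}(s)=e^{isL_0}L_{SR}e^{-isL_0}.$$ For $n\ge1$ and $t>0$ define the bounded operator on $\mathcal T(\mathcal H)$ $$K_n(t)=\int_{\Delta^{n+1}(t)}P L_{SR}(z_{n+1})Q L_{SR}(z_n)Q\cdots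 Q L_{SR}(z_1)Q L_{SR}P\,dz,\qquad \Delta^{n+1}(t)=\{0\le z_1\le\cdots\le z_{n+1}\le t\}.$$ **Correlation functions.** Let $V(z)=e^{izH_R}Ve^{-izH_R}$ and $z_0:=0$. For $A\subset\{0,\dots,n+1\}$ and an increasing finite sequence $a$ in $\{0,\dots,n+1\}$, let $a^A$ list first the entries of $a$ in $A$ in increasing order and then the entries of $a$ not in $A$ in decreasing order. Put $$\mathcal G_n(A,z)=\sum_{d}(-1)^{|d|+1}\prod_{s=1}^{|d|}\operatorname{tr}\Bigl(\prod_{k\in d_s^A}V(z_k)\,\omega_R\Bigr),$$ where $d=(d_1,\dots,d_{|d|})$ ranges over the partitions of the sequence $(0,1,\dots,n+1)$ into contiguous blocks of length at least $2$. **Assumptions.** (1) The function $\varphi(t)=\operatorname{tr}(V(t)V\omega_R)$ belongs to $L^1(\mathbb R)$. (2) (Clustering) There are $f:\mathbb R\to[0,\infty)$, $0<\epsilon<1$ and $C>0$ such that $\|f\|_{1,\epsilon}:=\int_{\mathbb R}f(s)(1+|s|)^\epsilon\,ds<\infty$ and, for all $m\ge1$, all $A\subset\{0,\dots,2m+1\}$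 and all $0=z_0\le z_1\le\dots\le z_{2m+1}$, $$|\mathcal G_{2m}(A,z)|\le\frac{C^{2m+2}}{m!}\sum_{p}\prod_{l=0}^{m}f\bigl(z_{p(2l)}-z_{p(2l+1)}\bigr),$$ where $p$ ranges over the permutations of $\{0,\dots,2m+1\}$ with $|p(1)-p(0)|\ge2$. **Proposition.** For all $m\ge1$ and $t>0$ the integral defining $K_{2m}(t)$ converges absolutely in operator norm, and $$\|K_{2m}(t)\|\le d_m\,t^{m-\epsilon},\qquad d_m=\frac{(2C\|W\|)^{2m+2}}{m!}\,(2m+2)!\,\|f\|_1^{m}\,\|f\|_{1,\epsilon}\,\xi_m^{(\epsilon)},$$ $$\xi_m^{(\epsilon)}=\max_{\substack{k,i\in\{0,\dots,m+1\}\\k>i+1}}\frac{(k-i-1-\epsilon)^{k-i-1-\epsilon}(m-k+i+1)^{m-k+i+1}}{(m-\epsilon)^{m-\epsilon}\,(k-i-1)!\,(m-k+i+1)!}\qquad(0^0:=1).$$ Here $\|f\|_1=\int_{\mathbb R}f$, and $\|K_{2m}(t)\|$ is the operator norm on $\mathcal T(\mathcal H)$. -/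

import Mathlib

open scoped TensorProduct InnerProductSpace
open InnerProductSpace

set_option linter.unusedSectionVars false

noncomputable section

namespace OpenSystem

section TraceClass

variable {H K : Type*} [NormedAddCommGroup H] [InnerProductSpace ℂ H] [CompleteSpace H]
  [NormedAddCommGroup K] [InnerProductSpace ℂ K] [CompleteSpace K]

/-- `T = ∑ i, |x i⟩⟨y i|` with `∑ i, ‖x i‖ * ‖y i‖ < ∞`. -/
def IsNuclearRep (T : H →L[ℂ] H) (x y : ℕ → H) : Prop :=
  Summable (fun i => ‖x i‖ * ‖y i‖) ∧ HasSum (fun i => rankOne ℂ (x i) (y i)) T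

/-- The trace norm of `T` is the infimum of `∑ i, ‖x i‖ * ‖y i‖` over all representations
`T = ∑ i, |x i⟩⟨y i|`. On a Hilbert space this is the trace of `|T|`. -/
def traceNorm (T : H →L[ℂ] H) : ℝ :=
  sInf {r | ∃ x y, IsNuclearRep T x y ∧ r = ∑' i, ‖x i‖ * ‖y i‖}

theorem IsNuclearRep.norm_le {T : H →L[ℂ] H} {x y : ℕ → H} (h : IsNuclearRep T x y) :
    ‖T‖ ≤ ∑' i, ‖x i‖ * ‖y i‖ := by
  rw [← h.2.tsum_eq]
  exact tsum_of_norm_bounded h.1.hasSum (fun i => by rw [norm_rankOne])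

theorem IsNuclearRep.traceNorm_le {T : H →L[ℂ] H} {x y : ℕ → H} (h : IsNuclearRep T x y) :
    traceNorm T ≤ ∑' i, ‖x i‖ * ‖y i‖ := by
  refine csInf_le ⟨0, ?_⟩ ⟨x, y, h, rfl⟩
  rintro r ⟨x, y, -, rfl⟩
  exact tsum_nonneg fun i => by positivity

theorem isNuclearRep_of_equiv {ι : Type*} (e : ℕ ≃ ι) {T : H →L[ℂ] H} {x y : ι → H}
    (h1 : Summable (fun i => ‖x i‖ * ‖y i‖)) (h2 : HasSum (fun i => rankOne ℂ (x i) (y i)) T) :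
    IsNuclearRep T (fun i => x (e i)) (fun i => y (e i)) ∧
      ∑' i, ‖x (e i)‖ * ‖y (e i)‖ = ∑' i, ‖x i‖ * ‖y i‖ := by
  refine ⟨⟨?_, ?_⟩, e.tsum_eq (fun i => ‖x i‖ * ‖y i‖)⟩
  · exact (e.summable_iff (f := fun i => ‖x i‖ * ‖y i‖)).2 h1
  · exact (e.hasSum_iff (f := fun i => rankOne ℂ (x i) (y i))).2 h2

theorem IsNuclearRep.add {T S : H →L[ℂ] H} {x y x' y' : ℕ → H} (h : IsNuclearRep T x y)
    (h' : IsNuclearRep S x' y') : ∃ a b, IsNuclearRep (T + S) a b ∧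
      ∑' i, ‖a i‖ * ‖b i‖ = (∑' i, ‖x i‖ * ‖y i‖) + ∑' i, ‖x' i‖ * ‖y' i‖ := by
  have hs : HasSum (fun i : ℕ ⊕ ℕ => ‖Sum.elim x x' i‖ * ‖Sum.elim y y' i‖)
      ((∑' i, ‖x i‖ * ‖y i‖) + ∑' i, ‖x' i‖ * ‖y' i‖) := h.1.hasSum.sum h'.1.hasSum
  have hT : HasSum (fun i : ℕ ⊕ ℕ => rankOne ℂ (Sum.elim x x' i) (Sum.elim y y' i)) (T + S) :=
    HasSum.sum h.2 h'.2
  obtain ⟨h1, h2⟩ := isNuclearRep_of_equiv Equiv.natSumNatEquivNat.symm hs.summable hT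
  exact ⟨_, _, h1, h2.trans hs.tsum_eq⟩

theorem IsNuclearRep.smul (c : ℂ) {T : H →L[ℂ] H} {x y : ℕ → H} (h : IsNuclearRep T x y) :
    IsNuclearRep (c • T) (fun i => c • x i) y ∧
      ∑' i, ‖c • x i‖ * ‖y i‖ = ‖c‖ * ∑' i, ‖x i‖ * ‖y i‖ := by
  have e : (fun i => ‖c • x i‖ * ‖y i‖) = fun i => ‖c‖ * (‖x i‖ * ‖y i‖) := by
    funext i; rw [norm_smul, mul_assoc]
  refine ⟨⟨?_, ?_⟩, ?_⟩
  · rw [e]; exact h.1.mul_left _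
  · simpa using h.2.const_smul c
  · rw [e, tsum_mul_left]

theorem IsNuclearRep.conj (A : H →L[ℂ] K) (B : K →L[ℂ] H) {T : H →L[ℂ] H} {x y : ℕ → H}
    (h : IsNuclearRep T x y) :
    IsNuclearRep (A ∘L T ∘L B) (fun i => A (x i)) (fun i => B.adjoint (y i)) := by
  constructor
  · refine Summable.of_nonneg_of_le (fun i => by positivity) (fun i => ?_)
      (h.1.mul_left (‖A‖ * ‖B‖))
    calc ‖A (x i)‖ * ‖B.adjoint (y i)‖ ≤ (‖A‖ * ‖x i‖) * (‖B‖ * ‖y i‖) := by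
          gcongr
          · exact A.le_opNorm _
          · simpa using B.adjoint.le_opNorm (y i)
      _ = ‖A‖ * ‖B‖ * (‖x i‖ * ‖y i‖) := by ring
  · let Φ : (H →L[ℂ] H) →L[ℂ] (K →L[ℂ] K) := (ContinuousLinearMap.compL ℂ K H K).flip B ∘L
      (ContinuousLinearMap.compL ℂ H H K) A
    have e : (fun i => rankOne ℂ (A (x i)) (B.adjoint (y i))) =
        fun i => Φ (rankOne ℂ (x i) (y i)) := by
      funext i
      ext v
      simp [Φ, ContinuousLinearMap.adjoint_inner_left]
    have hΦ : A ∘L T ∘L B = Φ T := rfl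
    rw [e, hΦ]
    exact h.2.mapL Φ

theorem isNuclearRep_zero : IsNuclearRep (0 : H →L[ℂ] H) 0 0 := by
  refine ⟨by simp, ?_⟩
  simp

theorem isNuclearRep_rankOne (u v : H) :
    IsNuclearRep (rankOne ℂ u v) (Pi.single 0 u) (Pi.single 0 v) := by
  constructor
  · refine summable_of_ne_finset_zero (s := {0}) fun i hi => ?_
    simp [Pi.single_eq_of_ne (by simpa using hi : i ≠ 0)]
  · convert hasSum_single (f := fun i => rankOne ℂ ((Pi.single 0 u : ℕ → H) i)
      ((Pi.single 0 v : ℕ → H) i)) 0 (fun i hi => by simp [Pi.single_eq_of_ne hi]) using 1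
    simp

variable (H) in
/-- The trace class operators as a subspace of the bounded operators. -/
def traceClass : Submodule ℂ (H →L[ℂ] H) where
  carrier := {T | ∃ x y, IsNuclearRep T x y}
  add_mem' := by
    rintro T S ⟨x, y, h⟩ ⟨x', y', h'⟩
    obtain ⟨a, b, hab, -⟩ := h.add h'
    exact ⟨a, b, hab⟩
  zero_mem' := ⟨0, 0, isNuclearRep_zero⟩
  smul_mem' := by
    rintro c T ⟨x, y, h⟩
    exact ⟨_, _, (h.smul c).1⟩

variable (H) in
/-- The space of trace class operators, which carries the trace norm. -/
def TraceClass : Type _ := traceClass H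

namespace TraceClass

instance : AddCommGroup (TraceClass H) := inferInstanceAs (AddCommGroup (traceClass H))
instance : Module ℂ (TraceClass H) := inferInstanceAs (Module ℂ (traceClass H))

/-- The operator underlying an element of the space of trace class operators. -/
def toOp : TraceClass H →ₗ[ℂ] H →L[ℂ] H := (traceClass H).subtype

instance : Norm (TraceClass H) := ⟨fun ρ => traceNorm (toOp ρ)⟩

theorem norm_def (ρ : TraceClass H) : ‖ρ‖ = traceNorm (toOp ρ) := rfl

theorem toOp_injective : Function.Injective (toOp : TraceClass H → H →L[ℂ] H) :=
  Subtype.val_injective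

theorem exists_rep (ρ : TraceClass H) : ∃ x y, IsNuclearRep (toOp ρ) x y := ρ.2

theorem exists_rep_lt (ρ : TraceClass H) {δ : ℝ} (hδ : 0 < δ) :
    ∃ x y, IsNuclearRep (toOp ρ) x y ∧ ∑' i, ‖x i‖ * ‖y i‖ < ‖ρ‖ + δ := by
  obtain ⟨x, y, h⟩ := exists_rep ρ
  obtain ⟨r, ⟨x, y, h, rfl⟩, hr⟩ := Real.lt_sInf_add_pos
    (s := {r | ∃ x y, IsNuclearRep (toOp ρ) x y ∧ r = ∑' i, ‖x i‖ * ‖y i‖}) ⟨_, x, y, h, rfl⟩ hδ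
  exact ⟨x, y, h, hr⟩

theorem norm_le_of_rep {ρ : TraceClass H} {x y : ℕ → H} (h : IsNuclearRep (toOp ρ) x y) :
    ‖ρ‖ ≤ ∑' i, ‖x i‖ * ‖y i‖ := h.traceNorm_le

theorem norm_toOp_le (ρ : TraceClass H) : ‖toOp ρ‖ ≤ ‖ρ‖ := by
  refine le_of_forall_pos_le_add fun δ hδ => ?_
  obtain ⟨x, y, h, hlt⟩ := exists_rep_lt ρ hδ
  exact h.norm_le.trans hlt.le

theorem norm_smul_le' (c : ℂ) (ρ : TraceClass H) : ‖c • ρ‖ ≤ ‖c‖ * ‖ρ‖ := by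
  have key : ∀ δ > 0, ‖c • ρ‖ ≤ ‖c‖ * (‖ρ‖ + δ) := by
    intro δ hδ
    obtain ⟨x, y, h, hlt⟩ := exists_rep_lt ρ hδ
    have h' := h.smul c
    calc ‖c • ρ‖ ≤ ∑' i, ‖c • x i‖ * ‖y i‖ := norm_le_of_rep (by rw [map_smul]; exact h'.1)
      _ = ‖c‖ * ∑' i, ‖x i‖ * ‖y i‖ := h'.2
      _ ≤ _ := by gcongr
  refine le_of_forall_pos_le_add fun δ hδ => ?_
  calc ‖c • ρ‖ ≤ ‖c‖ * (‖ρ‖ + δ / (‖c‖ + 1)) := key _ (by positivity)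
    _ = ‖c‖ * ‖ρ‖ + ‖c‖ / (‖c‖ + 1) * δ := by ring
    _ ≤ ‖c‖ * ‖ρ‖ + 1 * δ := by
        gcongr
        rw [div_le_one (by positivity)]; linarith
    _ = _ := by ring

theorem normedSpaceCore : NormedSpace.Core ℂ (TraceClass H) where
  norm_nonneg ρ := (norm_nonneg _).trans (norm_toOp_le ρ)
  norm_smul c ρ := by
    refine le_antisymm (norm_smul_le' c ρ) ?_
    rcases eq_or_ne c 0 with rfl | hc
    · have := (norm_nonneg _).trans (norm_toOp_le ((0 : ℂ) • ρ))
      simpa using this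
    · have := norm_smul_le' c⁻¹ (c • ρ)
      rw [smul_smul, inv_mul_cancel₀ hc, one_smul, norm_inv] at this
      have hc' : 0 < ‖c‖ := norm_pos_iff.2 hc
      calc ‖c‖ * ‖ρ‖ ≤ ‖c‖ * (‖c‖⁻¹ * ‖c • ρ‖) := by gcongr
        _ = ‖c • ρ‖ := by field_simp
  norm_triangle ρ σ := by
    refine le_of_forall_pos_le_add fun δ hδ => ?_
    obtain ⟨x, y, h, hlt⟩ := exists_rep_lt ρ (half_pos hδ)
    obtain ⟨x', y', h', hlt'⟩ := exists_rep_lt σ (half_pos hδ)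
    obtain ⟨a, b, hab, heq⟩ := h.add h'
    have := norm_le_of_rep (ρ := ρ + σ) (by rw [map_add]; exact hab)
    linarith
  norm_eq_zero_iff ρ := by
    constructor
    · intro h
      have := norm_toOp_le ρ
      rw [h] at this
      exact toOp_injective (by rw [norm_le_zero_iff.1 this, map_zero])
    · rintro rfl
      refine le_antisymm ?_ ((norm_nonneg _).trans (norm_toOp_le _))
      have := norm_le_of_rep (ρ := (0 : TraceClass H)) (by rw [map_zero]; exact isNuclearRep_zero)
      simpa using this

instance : NormedAddCommGroup (TraceClass H) := .ofCore normedSpaceCore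
instance : NormedSpace ℂ (TraceClass H) := .ofCore normedSpaceCore

theorem exists_hasSum {v : ℕ → TraceClass H} (hv : Summable fun k => ‖v k‖) :
    ∃ ρ : TraceClass H, HasSum (fun k => toOp (v k)) (toOp ρ) ∧ ‖ρ‖ ≤ ∑' k, ‖v k‖ := by
  have key : ∀ δ > 0, ∃ ρ : TraceClass H, HasSum (fun k => toOp (v k)) (toOp ρ) ∧
      ‖ρ‖ ≤ (∑' k, ‖v k‖) + δ * 2 := by
    intro δ hδ
    have hrep := fun k => exists_rep_lt (v k) (δ := δ * (1 / 2) ^ k) (by positivity)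
    choose x y h hlt using hrep
    have hgeo : Summable fun k : ℕ => δ * (1 / 2 : ℝ) ^ k := summable_geometric_two.mul_left δ
    have hs0 : Summable fun k => ∑' i, ‖x k i‖ * ‖y k i‖ :=
      Summable.of_nonneg_of_le (fun k => tsum_nonneg fun i => by positivity)
        (fun k => (hlt k).le) (hv.add hgeo)
    have hs : Summable fun p : ℕ × ℕ => ‖x p.1 p.2‖ * ‖y p.1 p.2‖ := by
      rw [summable_prod_of_nonneg (fun p => by positivity)]
      exact ⟨fun k => (h k).1, hs0⟩
    have hsT : Summable fun p : ℕ × ℕ => rankOne ℂ (x p.1 p.2) (y p.1 p.2) :=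
      Summable.of_norm (by simpa [norm_rankOne] using hs)
    have hT := hsT.hasSum
    have hv' := hT.prod_fiberwise (fun k => (h k).2)
    obtain ⟨h1, h2⟩ := isNuclearRep_of_equiv Nat.pairEquiv.symm
      (x := fun p : ℕ × ℕ => x p.1 p.2) (y := fun p : ℕ × ℕ => y p.1 p.2) hs hT
    refine ⟨⟨_, _, _, h1⟩, hv', (norm_le_of_rep (ρ := ⟨_, _, _, h1⟩) h1).trans ?_⟩
    rw [h2, hs.tsum_prod' (fun k => (h k).1)]
    calc ∑' k, ∑' i, ‖x k i‖ * ‖y k i‖ ≤ ∑' k, (‖v k‖ + δ * (1 / 2) ^ k) :=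
          hs0.tsum_le_tsum (fun k => (hlt k).le) (hv.add hgeo)
      _ = _ := by rw [hv.tsum_add hgeo, tsum_mul_left, tsum_geometric_two]
  obtain ⟨ρ, hρ, -⟩ := key 1 one_pos
  refine ⟨ρ, hρ, le_of_forall_pos_le_add fun δ hδ => ?_⟩
  obtain ⟨ρ', hρ', hle⟩ := key (δ / 2) (half_pos hδ)
  obtain rfl : ρ = ρ' := toOp_injective (hρ.unique hρ')
  linarith

instance : CompleteSpace (TraceClass H) := by
  refine NormedAddCommGroup.completeSpace_of_summable_imp_tendsto fun u hu => ?_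
  obtain ⟨ρ, hρ, -⟩ := exists_hasSum hu
  refine ⟨ρ, ?_⟩
  rw [tendsto_iff_norm_sub_tendsto_zero]
  refine squeeze_zero (fun _ => norm_nonneg _) (fun n => ?_) (tendsto_sum_nat_add fun k => ‖u k‖)
  have hu' : Summable fun k => ‖u (k + n)‖ := (summable_nat_add_iff n).2 hu
  obtain ⟨τ, hτ, hle⟩ := exists_hasSum hu'
  have : ρ - ∑ i ∈ Finset.range n, u i = τ := by
    refine toOp_injective ?_
    rw [map_sub, map_sum]
    exact ((hasSum_nat_add_iff' n).2 hρ).unique hτ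
  rw [norm_sub_rev, this]
  exact hle

/-- `ρ ↦ A ρ B`. -/
def conj (A : H →L[ℂ] K) (B : K →L[ℂ] H) : TraceClass H →L[ℂ] TraceClass K :=
  LinearMap.mkContinuous
    { toFun := fun ρ => ⟨A ∘L toOp ρ ∘L B, by
        obtain ⟨x, y, h⟩ := exists_rep ρ
        exact ⟨_, _, h.conj A B⟩⟩
      map_add' := fun ρ σ => toOp_injective (by
        change A ∘L toOp (ρ + σ) ∘L B = A ∘L toOp ρ ∘L B + A ∘L toOp σ ∘L B
        ext; simp)
      map_smul' := fun c ρ => toOp_injective (by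
        change A ∘L toOp (c • ρ) ∘L B = c • A ∘L toOp ρ ∘L B
        ext; simp) }
    (‖A‖ * ‖B‖) (fun ρ => by
      have key : ∀ δ > 0, traceNorm (A ∘L toOp ρ ∘L B) ≤ ‖A‖ * ‖B‖ * (‖ρ‖ + δ) := by
        intro δ hδ
        obtain ⟨x, y, h, hlt⟩ := exists_rep_lt ρ hδ
        refine (h.conj A B).traceNorm_le.trans ?_
        calc ∑' i, ‖A (x i)‖ * ‖B.adjoint (y i)‖
            ≤ ∑' i, ‖A‖ * ‖B‖ * (‖x i‖ * ‖y i‖) := by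
              refine (h.conj A B).1.tsum_le_tsum (fun i => ?_) (h.1.mul_left _)
              calc ‖A (x i)‖ * ‖B.adjoint (y i)‖ ≤ (‖A‖ * ‖x i‖) * (‖B‖ * ‖y i‖) := by
                    gcongr
                    · exact A.le_opNorm _
                    · simpa using B.adjoint.le_opNorm (y i)
                _ = ‖A‖ * ‖B‖ * (‖x i‖ * ‖y i‖) := by ring
          _ = ‖A‖ * ‖B‖ * ∑' i, ‖x i‖ * ‖y i‖ := tsum_mul_left
          _ ≤ _ := by gcongr
      refine le_of_forall_pos_le_add fun δ hδ => ?_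
      refine (key (δ / (‖A‖ * ‖B‖ + 1)) (by positivity)).trans ?_
      have : ‖A‖ * ‖B‖ * (δ / (‖A‖ * ‖B‖ + 1)) ≤ δ := by
        rw [mul_div_assoc', div_le_iff₀ (by positivity)]
        nlinarith
      rw [mul_add]
      gcongr)

@[simp] theorem toOp_conj (A : H →L[ℂ] K) (B : K →L[ℂ] H) (ρ : TraceClass H) :
    toOp (conj A B ρ) = A ∘L toOp ρ ∘L B := rfl

/-- The rank-one operator `|u⟩⟨v|`. -/
def ketBra (u v : H) : TraceClass H := ⟨rankOne ℂ u v, _, _, isNuclearRep_rankOne u v⟩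

@[simp] theorem toOp_ketBra (u v : H) : toOp (ketBra u v) = rankOne ℂ u v := rfl

end TraceClass

end TraceClass

section Tensor

variable {HS HR : Type*} [NormedAddCommGroup HS] [InnerProductSpace ℂ HS]
  [NormedAddCommGroup HR] [InnerProductSpace ℂ HR]

/-- `x ↦ x ⊗ e`. -/
def tensorVec (HS : Type*) [NormedAddCommGroup HS] [InnerProductSpace ℂ HS] (e : HR) :
    HS →L[ℂ] HS ⊗[ℂ] HR :=
  (TensorProduct.mkL ℂ HS HR).flip e

/-- The contraction `x ⊗ y ↦ ⟪e, y⟫ x`, which is the adjoint of `tensorVec HS e`. -/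
def contract (HS : Type*) [NormedAddCommGroup HS] [InnerProductSpace ℂ HS] (e : HR) :
    HS ⊗[ℂ] HR →L[ℂ] HS :=
  ((TensorProduct.ridIsometry ℂ HS).toContinuousLinearEquiv : HS ⊗[ℂ] ℂ →L[ℂ] HS) ∘L
    (innerSL ℂ e).lTensor HS

@[simp] theorem tensorVec_apply (e : HR) (x : HS) : tensorVec HS e x = x ⊗ₜ e := rfl

@[simp] theorem contract_tmul (e : HR) (x : HS) (y : HR) :
    contract HS e (x ⊗ₜ y) = ⟪e, y⟫_ℂ • x := by
  simp [contract]

theorem inner_contract (e : HR) (x : HS) (w : HS ⊗[ℂ] HR) :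
    ⟪x, contract HS e w⟫_ℂ = ⟪tensorVec HS e x, w⟫_ℂ := by
  induction w using TensorProduct.induction_on with
  | zero => simp
  | tmul a b => simp [mul_comm]
  | add a b ha hb => rw [map_add, inner_add_right, inner_add_right, ha, hb]

theorem contract_inner (e : HR) (x : HS) (w : HS ⊗[ℂ] HR) :
    ⟪contract HS e w, x⟫_ℂ = ⟪w, tensorVec HS e x⟫_ℂ := by
  rw [← inner_conj_symm, inner_contract]
  exact inner_conj_symm (𝕜 := ℂ) w (tensorVec HS e x)

instance [FiniteDimensional ℂ HS] [CompleteSpace HR] : CompleteSpace (HS ⊗[ℂ] HR) := by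
  let b := stdOrthonormalBasis ℂ HS
  let c : Fin (Module.finrank ℂ HS) → (HS ⊗[ℂ] HR →L[ℂ] HR) := fun i =>
    ((TensorProduct.lidIsometry ℂ HR).toContinuousLinearEquiv : ℂ ⊗[ℂ] HR →L[ℂ] HR) ∘L
      (innerSL ℂ (b i)).rTensor HR
  have hid : ∀ w : HS ⊗[ℂ] HR, ∑ i, TensorProduct.mkL ℂ HS HR (b i) (c i w) = w := by
    intro w
    induction w using TensorProduct.induction_on with
    | zero => simp
    | tmul x y =>
      have hc : ∀ i, c i (x ⊗ₜ y) = ⟪b i, x⟫_ℂ • y := fun i => by simp [c]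
      simp_rw [hc, map_smul, TensorProduct.mkL_apply_apply, TensorProduct.smul_tmul',
        ← TensorProduct.sum_tmul]
      rw [b.sum_repr' x]
    | add x y hx hy =>
      simp only [map_add, Finset.sum_add_distrib, hx, hy]
  refine Metric.complete_of_cauchySeq_tendsto fun u hu => ?_
  have h1 : ∀ i, ∃ y, Filter.Tendsto (fun n => c i (u n)) Filter.atTop (nhds y) := fun i =>
    cauchySeq_tendsto_of_complete (hu.map (c i).uniformContinuous)
  choose y hy using h1
  refine ⟨∑ i, TensorProduct.mkL ℂ HS HR (b i) (y i), ?_⟩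
  have h2 := tendsto_finsetSum (Finset.univ) (fun i _ =>
    ((TensorProduct.mkL ℂ HS HR (b i)).continuous.tendsto _).comp (hy i))
  refine h2.congr fun n => ?_
  simpa using hid (u n)

end Tensor

section PartialTrace

variable {HS HR : Type*} [NormedAddCommGroup HS] [InnerProductSpace ℂ HS]
  [FiniteDimensional ℂ HS] [NormedAddCommGroup HR] [InnerProductSpace ℂ HR] [CompleteSpace HR]

theorem adjoint_tensorVec (e : HR) : (tensorVec HS e).adjoint = contract HS e := by
  refine ((ContinuousLinearMap.eq_adjoint_iff _ _).2 fun w x => ?_).symm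
  exact contract_inner e x w

/-- Bessel's inequality for the contractions with an orthonormal family. -/
theorem sum_norm_contract_sq_le {ι : Type*} {v : ι → HR} (hv : Orthonormal ℂ v) (s : Finset ι)
    (w : HS ⊗[ℂ] HR) : ∑ k ∈ s, ‖contract HS (v k) w‖ ^ 2 ≤ ‖w‖ ^ 2 := by
  classical
  set S : ℝ := ∑ k ∈ s, ‖contract HS (v k) w‖ ^ 2 with hS
  let u : HS ⊗[ℂ] HR := ∑ k ∈ s, tensorVec HS (v k) (contract HS (v k) w)
  have hS0 : 0 ≤ S := Finset.sum_nonneg fun _ _ => by positivity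
  have huw : ⟪u, w⟫_ℂ = (S : ℂ) := by
    simp only [u, sum_inner, hS, Complex.ofReal_sum]
    refine Finset.sum_congr rfl fun k _ => ?_
    rw [← inner_contract, inner_self_eq_norm_sq_to_K]
    simp
  have huu : ‖u‖ ^ 2 = S := by
    have h1 : ⟪u, u⟫_ℂ = (S : ℂ) := by
      rw [← huw]
      conv_lhs => simp only [u]
      conv_rhs => simp only [u]
      simp only [sum_inner]
      refine Finset.sum_congr rfl fun k hk => ?_
      rw [← inner_contract, ← inner_contract, map_sum]
      congr 1
      rw [Finset.sum_eq_single k]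
      · simp [inner_self_eq_norm_sq_to_K, hv.1 k]
      · intro j _ hj
        simp [hv.2 hj.symm]
      · exact fun h => absurd hk h
    have h2 := (inner_self_eq_norm_sq_to_K (𝕜 := ℂ) u).symm.trans h1
    exact RCLike.ofReal_injective (K := ℂ) (by rw [RCLike.ofReal_pow]; exact h2)
  have h2 : S ≤ ‖u‖ * ‖w‖ := by
    have := norm_inner_le_norm (𝕜 := ℂ) u w
    rwa [huw, Complex.norm_real, Real.norm_of_nonneg hS0] at this
  have h3 : S ^ 2 ≤ S * ‖w‖ ^ 2 := by
    calc S ^ 2 ≤ (‖u‖ * ‖w‖) ^ 2 := by gcongr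
      _ = S * ‖w‖ ^ 2 := by rw [mul_pow, huu]
  rcases hS0.eq_or_lt with h | h
  · rw [← h]; positivity
  · nlinarith

theorem sum_norm_conj_contract_le {ι : Type*} {v : ι → HR} (hv : Orthonormal ℂ v) (s : Finset ι)
    (ρ : TraceClass (HS ⊗[ℂ] HR)) :
    ∑ k ∈ s, ‖TraceClass.conj (contract HS (v k)) (tensorVec HS (v k)) ρ‖ ≤ ‖ρ‖ := by
  refine le_of_forall_pos_le_add fun δ hδ => ?_
  obtain ⟨x, y, h, hlt⟩ := TraceClass.exists_rep_lt ρ hδ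
  have hk : ∀ k, IsNuclearRep
      (TraceClass.toOp (TraceClass.conj (contract HS (v k)) (tensorVec HS (v k)) ρ))
      (fun i => contract HS (v k) (x i)) (fun i => contract HS (v k) (y i)) := by
    intro k
    have := h.conj (contract HS (v k)) (tensorVec HS (v k))
    rwa [adjoint_tensorVec] at this
  calc ∑ k ∈ s, ‖TraceClass.conj (contract HS (v k)) (tensorVec HS (v k)) ρ‖
      ≤ ∑ k ∈ s, ∑' i, ‖contract HS (v k) (x i)‖ * ‖contract HS (v k) (y i)‖ :=
        Finset.sum_le_sum fun k _ => TraceClass.norm_le_of_rep (hk k)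
    _ = ∑' i, ∑ k ∈ s, ‖contract HS (v k) (x i)‖ * ‖contract HS (v k) (y i)‖ :=
        (Summable.tsum_finsetSum fun k _ => (hk k).1).symm
    _ ≤ ∑' i, ‖x i‖ * ‖y i‖ := by
        refine Summable.tsum_le_tsum (fun i => ?_) (summable_sum fun k _ => (hk k).1) h.1
        refine (Real.sum_mul_le_sqrt_mul_sqrt _ _ _).trans ?_
        have hx := Real.sqrt_le_sqrt (sum_norm_contract_sq_le (HS := HS) hv s (x i))
        have hy := Real.sqrt_le_sqrt (sum_norm_contract_sq_le (HS := HS) hv s (y i))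
        rw [Real.sqrt_sq (norm_nonneg _)] at hx hy
        gcongr
    _ ≤ ‖ρ‖ + δ := hlt.le

/-- The index set of a Hilbert basis of `H`. -/
def basisIndex (H : Type*) [NormedAddCommGroup H] [InnerProductSpace ℂ H] [CompleteSpace H] :
    Set H := (exists_hilbertBasis ℂ H).choose

/-- A Hilbert basis of `H`. -/
def basis (H : Type*) [NormedAddCommGroup H] [InnerProductSpace ℂ H] [CompleteSpace H] :
    HilbertBasis (basisIndex H) ℂ H := (exists_hilbertBasis ℂ H).choose_spec.choose

theorem summable_norm_conj_contract (ρ : TraceClass (HS ⊗[ℂ] HR)) :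
    Summable fun k => ‖TraceClass.conj (contract HS (basis HR k)) (tensorVec HS (basis HR k)) ρ‖ :=
  summable_of_sum_le (fun _ => norm_nonneg _)
    fun s => sum_norm_conj_contract_le (basis HR).orthonormal s ρ

/-- The partial trace `tr_R`, given by
`⟪x, tr_R(ρ) x'⟫ = ∑ k, ⟪x ⊗ e k, ρ (x' ⊗ e k)⟫` for a Hilbert basis `e` of `HR`. -/
def partialTrace (HS HR : Type*) [NormedAddCommGroup HS] [InnerProductSpace ℂ HS]
    [FiniteDimensional ℂ HS] [NormedAddCommGroup HR] [InnerProductSpace ℂ HR] [CompleteSpace HR] :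
    TraceClass (HS ⊗[ℂ] HR) →L[ℂ] TraceClass HS :=
  LinearMap.mkContinuous
    { toFun := fun ρ =>
        ∑' k, TraceClass.conj (contract HS (basis HR k)) (tensorVec HS (basis HR k)) ρ
      map_add' := fun ρ σ => by
        simp only [map_add]
        exact (summable_norm_conj_contract ρ).of_norm.tsum_add
          (summable_norm_conj_contract σ).of_norm
      map_smul' := fun c ρ => by
        simp only [map_smul, RingHom.id_apply]
        exact (summable_norm_conj_contract ρ).of_norm.tsum_const_smul c }
    1 (fun ρ => by
      rw [one_mul]
      refine (norm_tsum_le_tsum_norm (summable_norm_conj_contract ρ)).trans ?_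
      exact (summable_norm_conj_contract ρ).tsum_le_of_sum_le
        fun s => sum_norm_conj_contract_le (basis HR).orthonormal s ρ)

/-- The trace `∑ k, ⟪e k, T (e k)⟫` of a trace class operator `T`, for a Hilbert basis `e`. -/
def trace {H : Type*} [NormedAddCommGroup H] [InnerProductSpace ℂ H] [CompleteSpace H]
    (T : TraceClass H) : ℂ :=
  ∑' k, ⟪basis H k, TraceClass.toOp T (basis H k)⟫_ℂ

/-- `σ ↦ σ ⊗ |e⟩⟨e|`. -/
def tensorState (HS : Type*) [NormedAddCommGroup HS] [InnerProductSpace ℂ HS]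
    [FiniteDimensional ℂ HS] (e : HR) : TraceClass HS →L[ℂ] TraceClass (HS ⊗[ℂ] HR) :=
  TraceClass.conj (tensorVec HS e) (contract HS e)

theorem toOp_tensorState (e : HR) (σ : TraceClass HS) :
    TraceClass.toOp (tensorState HS e σ) =
      TensorProduct.mapL (TraceClass.toOp σ) (rankOne ℂ e e) := by
  refine ContinuousLinearMap.ext fun w => ?_
  induction w using TensorProduct.induction_on with
  | zero => simp
  | tmul x y => simp [tensorState]
  | add a b ha hb => rw [map_add, map_add, ha, hb]

end PartialTrace

section UnitaryGroup

variable {H : Type*} [NormedAddCommGroup H] [InnerProductSpace ℂ H]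

variable (H) in
/-- A strongly continuous one-parameter group of unitaries `U t = e^{-itH}`. Unitarity is stated
as preservation of the norm, since every `U t` is invertible with inverse `U (-t)`. -/
structure UnitaryGroup where
  op : ℝ → H →L[ℂ] H
  op_zero : op 0 = 1
  op_add : ∀ s t, op (s + t) = op s ∘L op t
  norm_op : ∀ t x, ‖op t x‖ = ‖x‖
  continuous_op : ∀ x, Continuous fun t => op t x

/-- The self-adjoint generator `H` of `U t = e^{-itH}`: its domain consists of the vectors `x` for
which `t ↦ U t x` is differentiable at `0`, and `H x = i (d/dt) U t x` at `t = 0`. -/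
def UnitaryGroup.generator (U : UnitaryGroup H) : H →ₗ.[ℂ] H where
  domain :=
    { carrier := {x | DifferentiableAt ℝ (fun t => U.op t x) 0}
      add_mem' := fun {x y} hx hy => by
        simp only [Set.mem_ofPred_eq, map_add] at *
        exact hx.fun_add hy
      zero_mem' := by simp
      smul_mem' := fun c x hx => by
        simp only [Set.mem_ofPred_eq, map_smul] at *
        exact hx.fun_const_smul c }
  toFun :=
    { toFun := fun x => Complex.I • deriv (fun t => U.op t (x : H)) 0
      map_add' := fun x y => by
        simp only [Submodule.coe_add, map_add]
        rw [deriv_fun_add x.2 y.2, smul_add]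
      map_smul' := fun c x => by
        simp only [Submodule.coe_smul, map_smul, RingHom.id_apply]
        rw [deriv_fun_const_smul c x.2, smul_comm] }

/-- The operator `e^{izH} A e^{-izH}`. -/
def UnitaryGroup.heisenberg (U : UnitaryGroup H) (A : H →L[ℂ] H) (z : ℝ) : H →L[ℂ] H :=
  U.op (-z) ∘L A ∘L U.op z

end UnitaryGroup

/-- A finite-dimensional system with space `HS` coupled to a reservoir with space `HR` through
`W ⊗ V`. The reservoir Hamiltonian is the generator of `groupR`. -/
structure Model (HS HR : Type*) [NormedAddCommGroup HS] [InnerProductSpace ℂ HS]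
    [FiniteDimensional ℂ HS] [NormedAddCommGroup HR] [InnerProductSpace ℂ HR]
    [CompleteSpace HR] where
  /-- the system Hamiltonian `H_S` -/
  hamS : HS →L[ℂ] HS
  hamS_selfAdjoint : IsSelfAdjoint hamS
  /-- the group `e^{-itH_R}` -/
  groupR : UnitaryGroup HR
  /-- the reference vector `Ω_R` of the reservoir -/
  Ω : HR
  norm_Ω : ‖Ω‖ = 1
  Ω_mem : Ω ∈ groupR.generator.domain
  generator_Ω : groupR.generator ⟨Ω, Ω_mem⟩ = 0
  W : HS →L[ℂ] HS
  W_selfAdjoint : IsSelfAdjoint W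
  V : HR →L[ℂ] HR
  V_selfAdjoint : IsSelfAdjoint V
  trace_V : trace (TraceClass.conj V 1 (TraceClass.ketBra Ω Ω)) = 0

/-- The times `z_0, z_1, …, z_{n+1}` with `z_0 = 0`, for a point `(z_1, …, z_{n+1})`. -/
def times {n : ℕ} (z : Fin (n + 1) → ℝ) : Fin (n + 2) → ℝ := Fin.cons 0 z

/-- The simplex `0 ≤ z_1 ≤ ⋯ ≤ z_n ≤ t`. -/
def simplex (n : ℕ) (t : ℝ) : Set (Fin n → ℝ) :=
  {z | Monotone z ∧ ∀ i, 0 ≤ z i ∧ z i ≤ t}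

namespace Model

variable {HS HR : Type*} [NormedAddCommGroup HS] [InnerProductSpace ℂ HS]
  [FiniteDimensional ℂ HS] [NormedAddCommGroup HR] [InnerProductSpace ℂ HR] [CompleteSpace HR]
  (M : Model HS HR)

/-- The reference state `ω_R = |Ω_R⟩⟨Ω_R|`. -/
def ω : TraceClass HR := TraceClass.ketBra M.Ω M.Ω

/-- `P ρ = tr_R(ρ) ⊗ ω_R`. -/
def P : TraceClass (HS ⊗[ℂ] HR) →L[ℂ] TraceClass (HS ⊗[ℂ] HR) :=
  tensorState HS M.Ω ∘L partialTrace HS HR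

/-- `Q = 1 - P`. -/
def Q : TraceClass (HS ⊗[ℂ] HR) →L[ℂ] TraceClass (HS ⊗[ℂ] HR) := 1 - M.P

/-- `e^{-itH_S} ⊗ e^{-itH_R} = e^{-it(H_S ⊗ 1 + 1 ⊗ H_R)}`. -/
def freeGroup (t : ℝ) : HS ⊗[ℂ] HR →L[ℂ] HS ⊗[ℂ] HR :=
  TensorProduct.mapL (NormedSpace.exp ((-(Complex.I * t)) • M.hamS)) (M.groupR.op t)

/-- `e^{-itL_0} ρ = e^{-itH_0} ρ e^{itH_0}`. -/
def freeEvolution (t : ℝ) : TraceClass (HS ⊗[ℂ] HR) →L[ℂ] TraceClass (HS ⊗[ℂ] HR) :=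
  TraceClass.conj (M.freeGroup t) (M.freeGroup (-t))

/-- `L_SR ρ = [W ⊗ V, ρ]`. -/
def liouvillian : TraceClass (HS ⊗[ℂ] HR) →L[ℂ] TraceClass (HS ⊗[ℂ] HR) :=
  TraceClass.conj (TensorProduct.mapL M.W M.V) 1 - TraceClass.conj 1 (TensorProduct.mapL M.W M.V)

/-- `L_SR(s) = e^{isL_0} L_SR e^{-isL_0}`. -/
def liouvillianAt (s : ℝ) : TraceClass (HS ⊗[ℂ] HR) →L[ℂ] TraceClass (HS ⊗[ℂ] HR) :=
  M.freeEvolution (-s) ∘L M.liouvillian ∘L M.freeEvolution s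

/-- `L_SR(z_n) Q L_SR(z_{n-1}) Q ⋯ Q L_SR(z_0)`. -/
def chain : (n : ℕ) → (Fin (n + 1) → ℝ) →
    TraceClass (HS ⊗[ℂ] HR) →L[ℂ] TraceClass (HS ⊗[ℂ] HR)
  | 0, z => M.liouvillianAt (z 0)
  | n + 1, z => M.liouvillianAt (z (Fin.last (n + 1))) ∘L M.Q ∘L chain n (fun i => z i.castSucc)

/-- `P L_SR(z_{n+1}) Q L_SR(z_n) Q ⋯ Q L_SR(z_1) Q L_SR P`. -/
def integrand (n : ℕ) (z : Fin (n + 1) → ℝ) :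
    TraceClass (HS ⊗[ℂ] HR) →L[ℂ] TraceClass (HS ⊗[ℂ] HR) :=
  M.P ∘L M.chain (n + 1) (times z) ∘L M.P

/-- `K_n(t) = ∫ P L_SR(z_{n+1}) Q ⋯ Q L_SR(z_1) Q L_SR P dz` over `0 ≤ z_1 ≤ ⋯ ≤ z_{n+1} ≤ t`. -/
def K (n : ℕ) (t : ℝ) : TraceClass (HS ⊗[ℂ] HR) →L[ℂ] TraceClass (HS ⊗[ℂ] HR) :=
  ∫ z in simplex (n + 1) t, M.integrand n z

/-- `V(z) = e^{izH_R} V e^{-izH_R}`. -/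
def Vt (z : ℝ) : HR →L[ℂ] HR := M.groupR.heisenberg M.V z

/-- `tr(V(z_{k_1}) ⋯ V(z_{k_r}) ω_R)` for a list `(k_1, …, k_r)`. -/
def correlation {n : ℕ} (z : Fin n → ℝ) (l : List (Fin n)) : ℂ :=
  trace (TraceClass.conj (l.map fun k => M.Vt (z k)).prod 1 M.ω)

/-- `φ(t) = tr(V(t) V ω_R)`. -/
def φ (t : ℝ) : ℂ := trace (TraceClass.conj (M.Vt t ∘L M.V) 1 M.ω)

end Model

/-- The rearrangement `a^A` of a list `a`: first the entries in `A`, in the order of `a`, then the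
entries outside `A`, in the reversed order. -/
def rearrange {n : ℕ} (A : Finset (Fin n)) (a : List (Fin n)) : List (Fin n) :=
  a.filter (· ∈ A) ++ (a.filter (· ∉ A)).reverse

/-- The partitions of the sequence `(0, …, n-1)` into contiguous blocks of length at least `2`. -/
def contiguousPartitions (n : ℕ) : Finset (Composition n) :=
  {d | ∀ b ∈ d.blocks, 2 ≤ b}

/-- The block of index `s`, as an increasing list. -/
def block {n : ℕ} (d : Composition n) (s : Fin d.length) : List (Fin n) :=
  List.ofFn (d.embedding s)

/-- `G_n(A, z) = ∑_d (-1)^{|d|+1} ∏_s tr(∏_{k ∈ d_s^A} V(z_k) ω_R)`, the sum being over the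
partitions of `(0, …, n+1)` into contiguous blocks of length at least `2`. -/
def Model.G {HS HR : Type*} [NormedAddCommGroup HS] [InnerProductSpace ℂ HS]
    [FiniteDimensional ℂ HS] [NormedAddCommGroup HR] [InnerProductSpace ℂ HR] [CompleteSpace HR]
    (M : Model HS HR) (n : ℕ) (A : Finset (Fin (n + 2))) (z : Fin (n + 1) → ℝ) : ℂ :=
  ∑ d ∈ contiguousPartitions (n + 2), (-1) ^ (d.length + 1) *
    ∏ s : Fin d.length, M.correlation (times z) (rearrange A (block d s))

/-- The permutations `p` of `{0, …, n-1}` with `|p(1) - p(0)| ≥ 2`. -/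
def gappedPerms (m : ℕ) : Finset (Equiv.Perm (Fin (2 * m + 2))) :=
  {p | 2 ≤ |((p ⟨1, by omega⟩ : ℕ) : ℤ) - ((p ⟨0, by omega⟩ : ℕ) : ℤ)|}

/-- The weighted norm `‖f‖_{1,ε} = ∫ f(s) (1 + |s|)^ε ds` of a non-negative `f`. -/
def weightedNorm (f : ℝ → ℝ) (ε : ℝ) : ℝ := ∫ s, f s * (1 + |s|) ^ ε

/-- The clustering property with the function `f`, the exponent `ε` and the constant `C`: the
connected correlation functions of an even number `2m + 2` of times are bounded by sums, over the
gapped permutations, of products of `m + 1` two-point functions, where `p` pairs the time of index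
`p(2l)` with the time of index `p(2l+1)`. -/
structure Clustering {HS HR : Type*} [NormedAddCommGroup HS] [InnerProductSpace ℂ HS]
    [FiniteDimensional ℂ HS] [NormedAddCommGroup HR] [InnerProductSpace ℂ HR] [CompleteSpace HR]
    (M : Model HS HR) (f : ℝ → ℝ) (ε C : ℝ) : Prop where
  nonneg : ∀ s, 0 ≤ f s
  ε_pos : 0 < ε
  ε_lt_one : ε < 1
  integrable : MeasureTheory.Integrable fun s => f s * (1 + |s|) ^ ε
  C_pos : 0 < C
  bound : ∀ m : ℕ, 1 ≤ m → ∀ (A : Finset (Fin (2 * m + 2))) (z : Fin (2 * m + 1) → ℝ),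
    Monotone z → (∀ i, 0 ≤ z i) →
      ‖M.G (2 * m) A z‖ ≤ C ^ (2 * m + 2) / (m.factorial : ℝ) *
        ∑ p ∈ gappedPerms m, ∏ l : Fin (m + 1),
          f (times z (p ⟨2 * l, by omega⟩) - times z (p ⟨2 * l + 1, by omega⟩))

/-- The maximum of
`(k-i-1-ε)^(k-i-1-ε) (m-k+i+1)^(m-k+i+1) / ((m-ε)^(m-ε) (k-i-1)! (m-k+i+1)!)`
over `k, i ∈ {0, …, m+1}` with `k > i + 1`, where `0^0 = 1`. -/
def ξ (m : ℕ) (ε : ℝ) : ℝ :=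
  sSup {x | ∃ k i : ℕ, k ≤ m + 1 ∧ i + 1 < k ∧
    x = ((k : ℝ) - i - 1 - ε) ^ ((k : ℝ) - i - 1 - ε) *
        ((m : ℝ) - k + i + 1) ^ ((m : ℝ) - k + i + 1) /
      (((m : ℝ) - ε) ^ ((m : ℝ) - ε) *
        ((k - i - 1).factorial : ℝ) * ((m + i + 1 - k).factorial : ℝ))}

/-- The constant
`d_m = (2 C w)^(2m+2) / m! * (2m+2)! * ‖f‖_1^m * ‖f‖_{1,ε} * ξ_m`, used with `w = ‖W‖`. -/
def boundConst (m : ℕ) (C w : ℝ) (f : ℝ → ℝ) (ε : ℝ) : ℝ :=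
  (2 * C * w) ^ (2 * m + 2) / (m.factorial : ℝ) * ((2 * m + 2).factorial : ℝ) *
    (∫ s, f s) ^ m * weightedNorm f ε * ξ m ε

end OpenSystem

end

/-! The argument has an algebraic and an analytic half.

Algebra. Each `L_SR(z_k)` is a left multiplication minus a right multiplication by `W(z_k) ⊗
V(z_k)`; let `A` be the set of indices where the right one is chosen. Applied to `σ ⊗ ω_R`, a
product of such one-sided multiplications keeps the reservoir factor of rank one, `|u⟩⟨v|`, and a
subsequent `P` replaces it by `⟪v, u⟫ ω_R`, where `⟪v, u⟫` is a correlation function. Writing every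
`Q` as `1 - P` cuts `(0, …, n+1)` into contiguous blocks, and the alternating sum of products of
block correlations is `G_n(A, z)`; blocks of length one drop out because `tr(V ω_R) = 0`
(`P_interleaved`, `compositionSum_eq_G`). The system factor has norm at most `‖W‖^(n+2)` and there
are `2^(n+2)` sets `A`, so the integrand is at most `(2‖W‖)^(n+2)` times any common bound of the
`|G_n(A, z)|` (`Model.norm_integrand_le`).

Analysis. Clustering leaves at most `(2m+2)!` integrals over the simplex of products of `m + 1` pair
functions. In each pair `l`, one time `r l` is retained and the other, `o l`, is freed: the order
constraints on it are dropped and it is integrated over the whole line, which gives `‖f‖_1`. The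
retained times, one of which is `z_0 = 0`, keep their order, so this alone would give a power `t^m`.
The gain `t^(-ε)` comes from the gap in the pair of index `0`: some time lies strictly between its
two times. With `u` the distance of these two, the times in between contribute a factor `u^j / j!`
with `j ≥ 1`, the other retained times contribute `(t-u)^(m-j) / (m-j)!`, and weighted AM-GM gives
`u^j (t-u)^(m-j) / (j! (m-j)!) ≤ u^ε t^(m-ε) ξ_m` (`pow_mul_pow_le_ξ`). The factor `u^ε` is absorbed
by the weight in `‖f‖_{1,ε}`.

The orientation of the pairs (`exists_pairing`) is chosen so that the time in the gap is retained.
This fails only if its partner is the time `0`; then it is the position of the pair of index `0`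
around that time that has freedom `u`, which again gives `j = 1` (`lintegral_pair_through_le`). -/

noncomputable section

namespace OpenSystem

/-! ### Unitary groups and their invariant vectors -/

section UnitaryGroupFacts

variable {H : Type*} [NormedAddCommGroup H] [InnerProductSpace ℂ H]

namespace UnitaryGroup

variable (U : UnitaryGroup H)

theorem op_neg_op (t : ℝ) (x : H) : U.op (-t) (U.op t x) = x := by
  have h := U.op_add (-t) t
  rw [neg_add_cancel, U.op_zero] at h
  exact (DFunLike.congr_fun h x).symm

theorem op_op_neg (t : ℝ) (x : H) : U.op t (U.op (-t) x) = x := by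
  simpa using U.op_neg_op (-t) x

theorem inner_op_op (t : ℝ) (x y : H) : ⟪U.op t x, U.op t y⟫_ℂ = ⟪x, y⟫_ℂ :=
  LinearIsometry.inner_map_map (⟨(U.op t).toLinearMap, U.norm_op t⟩ : H →ₗᵢ[ℂ] H) x y

theorem inner_op_neg (t : ℝ) (x y : H) : ⟪U.op (-t) x, y⟫_ℂ = ⟪x, U.op t y⟫_ℂ := by
  rw [← U.inner_op_op t, U.op_op_neg]

theorem inner_op (t : ℝ) (x y : H) : ⟪U.op t x, y⟫_ℂ = ⟪x, U.op (-t) y⟫_ℂ := by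
  rw [← U.inner_op_op (-t), U.op_neg_op]

/-- Joint continuity follows from strong continuity because every `U t` is an isometry: the change
of the vector costs only its own norm, whatever the time. -/
theorem continuous_op_apply {X : Type*} [TopologicalSpace X] {s : X → ℝ} {v : X → H}
    (hs : Continuous s) (hv : Continuous v) : Continuous fun x => U.op (s x) (v x) := by
  rw [continuous_iff_continuousAt]
  intro a
  have h1 : Filter.Tendsto (fun x => U.op (s x) (v x - v a)) (nhds a) (nhds 0) := by
    rw [tendsto_zero_iff_norm_tendsto_zero]
    simp only [U.norm_op]
    have := (hv.sub (continuous_const (y := v a))).norm.tendsto a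
    simpa using this
  have h2 : Filter.Tendsto (fun x => U.op (s x) (v a)) (nhds a) (nhds (U.op (s a) (v a))) :=
    ((U.continuous_op (v a)).comp hs).tendsto a
  have h3 := h1.add h2
  rw [zero_add] at h3
  refine h3.congr fun x => ?_
  rw [map_sub, sub_add_cancel]

/-- By the group law the derivative of the orbit at time `s` is `U s` applied to its derivative at
`0`, which vanishes, so the orbit is constant. -/
theorem op_apply_of_generator_eq_zero {x : H} (hx : x ∈ U.generator.domain)
    (h : U.generator ⟨x, hx⟩ = 0) (t : ℝ) : U.op t x = x := by
  have hd : DifferentiableAt ℝ (fun t => U.op t x) 0 := hx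
  have h0 : deriv (fun t => U.op t x) 0 = 0 := by
    have h' : Complex.I • deriv (fun t => U.op t x) 0 = 0 := h
    exact (smul_eq_zero.1 h').resolve_left Complex.I_ne_zero
  have hd0 : HasDerivAt (fun t => U.op t x) 0 0 := by
    rw [← h0]; exact hd.hasDerivAt
  have key : ∀ s, HasDerivAt (fun t => U.op t x) 0 s := by
    intro s
    have h1 : HasDerivAt (fun t => U.op (t - s) x) 0 s := by
      have := HasDerivAt.scomp (g₁ := fun t => U.op t x) (h := fun t => t - s) s
        (by simpa using hd0) ((hasDerivAt_id s).sub_const s)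
      simpa [Function.comp_def] using this
    have h2 := ((U.op s).restrictScalars ℝ).hasFDerivAt.comp_hasDerivAt s h1
    simp only [map_zero] at h2
    refine h2.congr_of_eventuallyEq (Filter.Eventually.of_forall fun t => ?_)
    have : U.op (s + (t - s)) x = U.op s (U.op (t - s) x) := by rw [U.op_add]; rfl
    simpa using this
  have hdiff : Differentiable ℝ fun t => U.op t x := fun s => (key s).differentiableAt
  have := is_const_of_deriv_eq_zero hdiff (fun s => (key s).deriv) t 0
  simpa [U.op_zero] using this

theorem inner_heisenberg {A : H →L[ℂ] H} (hA : ∀ x y, ⟪A x, y⟫_ℂ = ⟪x, A y⟫_ℂ) (z : ℝ) (x y : H) :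
    ⟪U.heisenberg A z x, y⟫_ℂ = ⟪x, U.heisenberg A z y⟫_ℂ := by
  simp only [heisenberg, ContinuousLinearMap.comp_apply]
  rw [U.inner_op_neg, hA, U.inner_op]

end UnitaryGroup

end UnitaryGroupFacts

/-! ### Two-sided multiplications on trace class operators -/

section TraceFacts

variable {H K L : Type*} [NormedAddCommGroup H] [InnerProductSpace ℂ H] [CompleteSpace H]
  [NormedAddCommGroup K] [InnerProductSpace ℂ K] [CompleteSpace K]
  [NormedAddCommGroup L] [InnerProductSpace ℂ L] [CompleteSpace L]

namespace TraceClass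

theorem norm_conj_le (A : H →L[ℂ] K) (B : K →L[ℂ] H) : ‖conj A B‖ ≤ ‖A‖ * ‖B‖ :=
  LinearMap.mkContinuous_norm_le _ (by positivity) _

theorem conj_conj (A : K →L[ℂ] L) (B : L →L[ℂ] K) (A' : H →L[ℂ] K) (B' : K →L[ℂ] H)
    (ρ : TraceClass H) : conj A B (conj A' B' ρ) = conj (A ∘L A') (B' ∘L B) ρ :=
  toOp_injective (by ext; simp)

theorem continuous_conj_left (B : K →L[ℂ] H) :
    Continuous fun A : H →L[ℂ] K => (conj A B : TraceClass H →L[ℂ] TraceClass K) := by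
  refine LipschitzWith.continuous (K := ‖B‖₊) (LipschitzWith.of_dist_le_mul fun A A' => ?_)
  have h : conj A B - conj A' B = conj (A - A') B := by
    ext1 ρ
    exact toOp_injective (by ext; simp)
  rw [dist_eq_norm, dist_eq_norm, h, mul_comm]
  exact norm_conj_le _ _

theorem continuous_conj_right (A : H →L[ℂ] K) :
    Continuous fun B : K →L[ℂ] H => (conj A B : TraceClass H →L[ℂ] TraceClass K) := by
  refine LipschitzWith.continuous (K := ‖A‖₊) (LipschitzWith.of_dist_le_mul fun B B' => ?_)
  have h : conj A B - conj A B' = conj A (B - B') := by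
    ext1 ρ
    exact toOp_injective (by ext; simp)
  rw [dist_eq_norm, dist_eq_norm, h]
  exact norm_conj_le _ _

end TraceClass

/-- Parseval's identity for `⟪v, A u⟫` in the basis that defines the trace. -/
theorem trace_conj_ketBra (A : H →L[ℂ] H) (u v : H) :
    trace (TraceClass.conj A 1 (TraceClass.ketBra u v)) = ⟪v, A u⟫_ℂ := by
  rw [trace]
  simp only [TraceClass.toOp_conj, TraceClass.toOp_ketBra, ContinuousLinearMap.comp_apply,
    one_apply_eq_self, rankOne_apply, map_smul, inner_smul_right]
  exact (basis H).tsum_inner_mul_inner v (A u)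

end TraceFacts

/-! ### Partial trace of product operators -/

section PartialTraceFacts

variable {HS HR : Type*} [NormedAddCommGroup HS] [InnerProductSpace ℂ HS]
  [FiniteDimensional ℂ HS] [NormedAddCommGroup HR] [InnerProductSpace ℂ HR] [CompleteSpace HR]

/-- `σ ↦ σ ⊗ |u⟩⟨v|`. -/
def tensorKetBra (HS : Type*) [NormedAddCommGroup HS] [InnerProductSpace ℂ HS]
    [FiniteDimensional ℂ HS] (u v : HR) : TraceClass HS →L[ℂ] TraceClass (HS ⊗[ℂ] HR) :=
  TraceClass.conj (tensorVec HS u) (contract HS v)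

theorem norm_tensorVec_le (e : HR) : ‖tensorVec HS e‖ ≤ ‖e‖ :=
  ContinuousLinearMap.opNorm_le_bound _ (norm_nonneg _) fun x => by
    simp [TensorProduct.norm_tmul, mul_comm]

theorem norm_contract_le (e : HR) : ‖contract HS e‖ ≤ ‖e‖ := by
  rw [← adjoint_tensorVec, LinearIsometryEquiv.norm_map]
  exact norm_tensorVec_le e

theorem norm_tensorState_le (e : HR) : ‖tensorState HS e‖ ≤ ‖e‖ * ‖e‖ := by
  refine (TraceClass.norm_conj_le _ _).trans ?_
  gcongr
  · exact norm_tensorVec_le e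
  · exact norm_contract_le e

theorem norm_partialTrace_le : ‖partialTrace HS HR‖ ≤ 1 :=
  LinearMap.mkContinuous_norm_le _ zero_le_one _

/-- Contraction with one basis vector produces one term of the Parseval series of `⟪v, u⟫`. This is
the step by which `P` turns reservoir vectors into scalar correlation functions. -/
theorem partialTrace_tensorKetBra (u v : HR) (σ : TraceClass HS) :
    partialTrace HS HR (tensorKetBra HS u v σ) = ⟪v, u⟫_ℂ • σ := by
  have h1 : ∀ k, TraceClass.conj (contract HS (basis HR k)) (tensorVec HS (basis HR k))
      (tensorKetBra HS u v σ) = (⟪v, basis HR k⟫_ℂ * ⟪(basis HR k : HR), u⟫_ℂ) • σ := by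
    intro k
    refine TraceClass.toOp_injective ?_
    ext x
    simp only [tensorKetBra, TraceClass.toOp_conj, ContinuousLinearMap.comp_apply,
      tensorVec_apply, contract_tmul, map_smul, smul_apply, smul_smul]
  change ∑' k, TraceClass.conj (contract HS (basis HR k)) (tensorVec HS (basis HR k))
      (tensorKetBra HS u v σ) = _
  simp only [h1]
  exact (((basis HR).hasSum_inner_mul_inner v u).smul_const σ).tsum_eq

theorem conj_mapL_left (A : HS →L[ℂ] HS) (B : HR →L[ℂ] HR) (u v : HR) (σ : TraceClass HS) :
    TraceClass.conj (TensorProduct.mapL A B) 1 (tensorKetBra HS u v σ) =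
      tensorKetBra HS (B u) v (TraceClass.conj A 1 σ) := by
  rw [tensorKetBra, tensorKetBra, TraceClass.conj_conj, TraceClass.conj_conj]
  congr 2

/-- Multiplication from the right changes `⟨v|` into the bra of the adjoint applied to `v`; symmetry
of `B` makes this `B v`. -/
theorem conj_mapL_right (A : HS →L[ℂ] HS) {B : HR →L[ℂ] HR}
    (hB : ∀ x y, ⟪B x, y⟫_ℂ = ⟪x, B y⟫_ℂ) (u v : HR) (σ : TraceClass HS) :
    TraceClass.conj 1 (TensorProduct.mapL A B) (tensorKetBra HS u v σ) =
      tensorKetBra HS u (B v) (TraceClass.conj 1 A σ) := by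
  rw [tensorKetBra, tensorKetBra, TraceClass.conj_conj, TraceClass.conj_conj]
  congr 2
  refine ContinuousLinearMap.ext fun w => ?_
  induction w using TensorProduct.induction_on with
  | zero => simp
  | tmul x y => simp [hB]
  | add a b ha hb => rw [map_add, map_add, ha, hb]

end PartialTraceFacts

/-! ### Alternating sums over compositions -/

section Compositions

/-- The alternating sum `∑_d (-1)^(|d|+1) ∏_s c (start of d_s) (end of d_s)` over the compositions
`d` of `n`. -/
def compositionSum (c : ℕ → ℕ → ℂ) (n : ℕ) : ℂ :=
  ∑ d : Composition n, (-1) ^ (d.length + 1) *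
    ∏ s ∈ Finset.range d.length, c (d.sizeUpTo s) (d.sizeUpTo (s + 1))

/-- The empty composition has sign `(-1)^(0+1)`. With this value the term `j = 0` of
`compositionSum_eq` is the composition into a single block, with sign `+1`. -/
theorem compositionSum_zero (c : ℕ → ℕ → ℂ) : compositionSum c 0 = -1 := by
  have : ∀ d : Composition 0, d.length = 0 := fun d => by simp
  simp [compositionSum, this, composition_card]

/-- The composition of `n` obtained from a composition of `j < n` by adding a last block. -/
def Composition.extend {n : ℕ} {j : ℕ} (hj : j < n) (d : Composition j) : Composition n where
  blocks := d.blocks ++ [n - j]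
  blocks_pos := by
    intro i hi
    rcases List.mem_append.1 hi with h | h
    · exact d.blocks_pos h
    · rw [List.mem_singleton.1 h]; omega
  blocks_sum := by simp [d.blocks_sum]; omega

theorem Composition.length_extend {n j : ℕ} (hj : j < n) (d : Composition j) :
    (Composition.extend hj d).length = d.length + 1 := by
  simp [Composition.extend, Composition.length]

theorem Composition.sizeUpTo_extend {n j : ℕ} (hj : j < n) (d : Composition j) {i : ℕ}
    (hi : i ≤ d.length) : (Composition.extend hj d).sizeUpTo i = d.sizeUpTo i := by
  simp only [Composition.extend, Composition.sizeUpTo]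
  rw [List.take_append_of_le_length (by simpa using hi)]

/-- A composition of `n > 0` is determined by the start `j` of its last block and the composition of
`j` formed by the other blocks. Removing the last block flips the sign. -/
theorem compositionSum_eq (c : ℕ → ℕ → ℂ) {n : ℕ} (hn : 0 < n) :
    compositionSum c n = -∑ j ∈ Finset.range n, c j n * compositionSum c j := by
  have h1 : ∑ j ∈ Finset.range n, c j n * compositionSum c j =
      ∑ x : (Σ j : Fin n, Composition j), c x.1 n * ((-1) ^ (x.2.length + 1) *
        ∏ s ∈ Finset.range x.2.length, c (x.2.sizeUpTo s) (x.2.sizeUpTo (s + 1))) := by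
    rw [Finset.sum_range fun j => c j n * compositionSum c j, Fintype.sum_sigma]
    refine Finset.sum_congr rfl fun j _ => ?_
    rw [compositionSum, Finset.mul_sum]
  rw [h1, ← Finset.sum_neg_distrib, compositionSum]
  symm
  refine Finset.sum_bij (fun x _ => Composition.extend x.1.2 x.2) (fun _ _ => Finset.mem_univ _)
    ?_ ?_ ?_
  · rintro ⟨⟨j, hj⟩, d⟩ - ⟨⟨j', hj'⟩, d'⟩ - h
    have hb : d.blocks ++ [n - j] = d'.blocks ++ [n - j'] := congrArg Composition.blocks h
    obtain ⟨hb1, -⟩ := List.append_inj' hb rfl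
    obtain rfl : j = j' := by
      have := congrArg List.sum hb1
      rwa [d.blocks_sum, d'.blocks_sum] at this
    obtain rfl : d = d' := Composition.ext hb1
    rfl
  · intro d _
    rcases List.eq_nil_or_concat d.blocks with h | ⟨l, b, h⟩
    · have := d.blocks_sum
      rw [h] at this
      simp at this
      omega
    · have hsum := d.blocks_sum
      rw [h] at hsum
      simp at hsum
      have hb : 0 < b := d.blocks_pos (by rw [h]; simp)
      refine ⟨⟨⟨l.sum, by omega⟩, ⟨l, fun {i} hi => d.blocks_pos (by rw [h]; simp [hi]), rfl⟩⟩,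
        Finset.mem_univ _, ?_⟩
      refine Composition.ext ?_
      refine Eq.trans (b := l ++ [n - l.sum]) rfl (Eq.trans ?_ h.symm)
      rw [List.concat_eq_append]
      congr 2
      omega
  · rintro ⟨⟨j, hj⟩, d⟩ -
    simp only [Composition.length_extend, Finset.prod_range_succ]
    have h2 : (Composition.extend hj d).sizeUpTo d.length = j := by
      rw [Composition.sizeUpTo_extend hj d le_rfl, d.sizeUpTo_length]
    have h3 : (Composition.extend hj d).sizeUpTo (d.length + 1) = n := by
      rw [← Composition.length_extend hj d, Composition.sizeUpTo_length]
    have h4 : ∏ s ∈ Finset.range d.length, c ((Composition.extend hj d).sizeUpTo s)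
          ((Composition.extend hj d).sizeUpTo (s + 1)) =
        ∏ s ∈ Finset.range d.length, c (d.sizeUpTo s) (d.sizeUpTo (s + 1)) := by
      refine Finset.prod_congr rfl fun s hs => ?_
      have hs' := Finset.mem_range.1 hs
      rw [Composition.sizeUpTo_extend hj d hs'.le, Composition.sizeUpTo_extend hj d hs']
    rw [h2, h3, h4]
    ring

/-- A block of length one contributes a factor `c j (j + 1) = 0`, so only compositions into blocks
of length at least two survive. -/
theorem compositionSum_eq_sum_contiguousPartitions {c : ℕ → ℕ → ℂ} (hc : ∀ j, c j (j + 1) = 0)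
    (n : ℕ) : compositionSum c n = ∑ d ∈ contiguousPartitions n, (-1) ^ (d.length + 1) *
      ∏ s : Fin d.length, c (d.sizeUpTo s) (d.sizeUpTo (s + 1)) := by
  have h : ∀ d : Composition n, ∏ s : Fin d.length, c (d.sizeUpTo s) (d.sizeUpTo (s + 1)) =
      ∏ s ∈ Finset.range d.length, c (d.sizeUpTo s) (d.sizeUpTo (s + 1)) := fun d =>
    (Finset.prod_range fun s => c (d.sizeUpTo s) (d.sizeUpTo (s + 1))).symm
  simp only [h]
  symm
  refine Finset.sum_subset (Finset.subset_univ _) fun d _ hd => ?_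
  have hd' : ∃ b ∈ d.blocks, b < 2 := by
    by_contra! hcon
    exact hd (by simpa [contiguousPartitions] using hcon)
  obtain ⟨b, hb, hb2⟩ := hd'
  obtain ⟨s, hs, rfl⟩ := List.getElem_of_mem hb
  have hpos := d.blocks_pos hb
  rw [mul_eq_zero]
  refine Or.inr (Finset.prod_eq_zero (Finset.mem_range.2 hs) ?_)
  rw [d.sizeUpTo_succ hs, show d.blocks[s] = 1 by omega]
  exact hc _

end Compositions

/-! ### Expansion of products interleaved with `1 - p` -/

section Chains

variable {E : Type*} [Ring E]

/-- `D_n (1 - p) D_{n-1} (1 - p) ⋯ (1 - p) D_0`. -/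
def interleaved (p : E) (D : ℕ → E) : ℕ → E
  | 0 => D 0
  | n + 1 => D (n + 1) * ((1 - p) * interleaved p D n)

/-- `D_{j+i-1} ⋯ D_{j+1} D_j`. -/
def descProd (D : ℕ → E) (j : ℕ) : ℕ → E
  | 0 => 1
  | i + 1 => D (j + i) * descProd D j i

theorem interleaved_congr (p : E) {D D' : ℕ → E} {n : ℕ} (h : ∀ k ≤ n, D k = D' k) :
    interleaved p D n = interleaved p D' n := by
  induction n with
  | zero => exact h 0 le_rfl
  | succ n ih => rw [interleaved, interleaved, h _ le_rfl, ih fun k hk => h k (by omega)]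

/-- The interleaved product is additive in each factor; `A` records the positions at which `b` is
chosen. -/
theorem interleaved_add (p : E) (a b : ℕ → E) (n : ℕ) :
    interleaved p (fun k => a k + b k) n = ∑ A ∈ (Finset.range (n + 1)).powerset,
      interleaved p (fun k => if k ∈ A then b k else a k) n := by
  induction n with
  | zero =>
    rw [Finset.range_add_one, Finset.sum_powerset_insert Finset.notMem_range_self]
    simp [interleaved]
  | succ n ih =>
    rw [Finset.range_add_one, Finset.sum_powerset_insert Finset.notMem_range_self]
    have h1 : ∀ A ∈ (Finset.range (n + 1)).powerset,
        interleaved p (fun k => if k ∈ A then b k else a k) (n + 1) = a (n + 1) * ((1 - p) *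
          interleaved p (fun k => if k ∈ A then b k else a k) n) := by
      intro A hA
      have hn : n + 1 ∉ A := fun h => by simpa using Finset.mem_powerset.1 hA h
      rw [interleaved, if_neg hn]
    have h2 : ∀ A ∈ (Finset.range (n + 1)).powerset,
        interleaved p (fun k => if k ∈ insert (n + 1) A then b k else a k) (n + 1) =
          b (n + 1) * ((1 - p) * interleaved p (fun k => if k ∈ A then b k else a k) n) := by
      intro A hA
      rw [interleaved, if_pos (Finset.mem_insert_self _ _)]
      congr 2
      refine interleaved_congr p fun k hk => ?_
      have : k ∈ insert (n + 1) A ↔ k ∈ A := by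
        rw [Finset.mem_insert]
        exact or_iff_right (by omega)
      simp only [this]
    rw [Finset.sum_congr rfl h1, Finset.sum_congr rfl h2, ← Finset.mul_sum, ← Finset.mul_sum,
      ← Finset.mul_sum, ← Finset.mul_sum, ← ih, interleaved, add_mul]

/-- The factors `1 - p` are expanded from the left only up to the leftmost `p`, and `D i` is the
factor just to its right. What follows that `p` stays an interleaved product, which gives a
recursion of the same shape as `compositionSum_eq`. -/
theorem interleaved_eq (p : E) (D : ℕ → E) (n : ℕ) :
    interleaved p D n = descProd D 0 (n + 1) -
      ∑ i ∈ Finset.range n, descProd D (i + 1) (n - i) * (p * interleaved p D i) := by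
  induction n with
  | zero => simp [interleaved, descProd]
  | succ n ih =>
    have h : ∀ i ∈ Finset.range n, descProd D (i + 1) (n + 1 - i) * (p * interleaved p D i) =
        D (n + 1) * (descProd D (i + 1) (n - i) * (p * interleaved p D i)) := by
      intro i hi
      have hi' := Finset.mem_range.1 hi
      rw [show n + 1 - i = n - i + 1 by omega, descProd, mul_assoc]
      congr 2
      omega
    rw [Finset.sum_range_succ, Finset.sum_congr rfl h, ← Finset.mul_sum,
      show n + 1 - n = 0 + 1 by omega, interleaved, sub_mul, one_mul, mul_sub,
      show descProd D 0 (n + 1 + 1) = D (n + 1) * descProd D 0 (n + 1) by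
        rw [descProd, zero_add]]
    simp only [descProd, mul_one, add_zero]
    conv_lhs => rw [ih]
    rw [mul_sub, ih]
    simp only [descProd]
    abel

theorem descProd_add (D : ℕ → E) (j i k : ℕ) :
    descProd D j (i + k) = descProd D (j + i) k * descProd D j i := by
  induction k with
  | zero => simp [descProd]
  | succ k ih => rw [← add_assoc, descProd, ih, descProd, mul_assoc, add_assoc]

end Chains

/-! ### The integrand in terms of the correlation functions -/

namespace Model

variable {HS HR : Type*} [NormedAddCommGroup HS] [InnerProductSpace ℂ HS]
  [FiniteDimensional ℂ HS] [NormedAddCommGroup HR] [InnerProductSpace ℂ HR] [CompleteSpace HR]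
  (M : Model HS HR)

/-- `e^{-itH_S}`. -/
def groupS (t : ℝ) : HS →L[ℂ] HS := NormedSpace.exp ((-(Complex.I * t)) • M.hamS)

/-- `W(s) = e^{isH_S} W e^{-isH_S}`. -/
def Wt (s : ℝ) : HS →L[ℂ] HS := M.groupS (-s) ∘L M.W ∘L M.groupS s

theorem groupS_neg_comp (t : ℝ) : M.groupS (-t) ∘L M.groupS t = 1 := by
  have h : M.groupS (-t) * M.groupS t = 1 := by
    let +nondep : NormedAlgebra ℚ (HS →L[ℂ] HS) := .restrictScalars ℚ ℂ _
    rw [groupS, groupS, ← NormedSpace.exp_add_of_commute]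
    · rw [← add_smul]; simp
    · exact ((Commute.refl M.hamS).smul_left _).smul_right _
  exact h

theorem groupS_mem_unitary (t : ℝ) : M.groupS t ∈ unitary (HS →L[ℂ] HS) := by
  have h : (-(t : ℂ)) • M.hamS ∈ selfAdjoint (HS →L[ℂ] HS) := by
    rw [selfAdjoint.mem_iff, star_smul, M.hamS_selfAdjoint.star_eq]; simp
  have := (selfAdjoint.expUnitary ⟨_, h⟩).2
  rw [selfAdjoint.expUnitary_coe] at this
  rw [smul_smul, mul_neg] at this
  exact this

theorem norm_Wt (s : ℝ) : ‖M.Wt s‖ = ‖M.W‖ := by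
  have h1 := CStarRing.norm_coe_unitary_mul ⟨_, M.groupS_mem_unitary (-s)⟩ (M.W * M.groupS s)
  have h2 := CStarRing.norm_mul_coe_unitary M.W ⟨_, M.groupS_mem_unitary s⟩
  exact h1.trans h2

theorem continuous_groupS : Continuous M.groupS := by
  unfold groupS
  let +nondep : NormedAlgebra ℚ (HS →L[ℂ] HS) := .restrictScalars ℚ ℂ _
  exact NormedSpace.exp_continuous.comp (by fun_prop)

theorem continuous_Wt : Continuous M.Wt := by
  unfold Wt
  have h1 := M.continuous_groupS
  have h2 : Continuous fun s => M.groupS (-s) := h1.comp continuous_neg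
  exact h2.clm_comp (continuous_const.clm_comp h1)

theorem freeGroup_neg_comp (t : ℝ) : M.freeGroup (-t) ∘L M.freeGroup t = 1 := by
  refine ContinuousLinearMap.ext fun w => ?_
  induction w using TensorProduct.induction_on with
  | zero => simp
  | tmul x y =>
    have h := DFunLike.congr_fun (M.groupS_neg_comp t) x
    simp only [ContinuousLinearMap.comp_apply, one_apply_eq_self, groupS] at h
    simp only [freeGroup, ContinuousLinearMap.comp_apply, TensorProduct.mapL_tmul,
      one_apply_eq_self, UnitaryGroup.op_neg_op]
    rw [h]
  | add a b ha hb => rw [map_add, map_add, ha, hb]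

theorem freeGroup_conj (s : ℝ) :
    M.freeGroup (-s) ∘L TensorProduct.mapL M.W M.V ∘L M.freeGroup s =
      TensorProduct.mapL (M.Wt s) (M.Vt s) := by
  refine ContinuousLinearMap.ext fun w => ?_
  induction w using TensorProduct.induction_on with
  | zero => simp
  | tmul x y => simp [freeGroup, Wt, Vt, groupS, UnitaryGroup.heisenberg]
  | add a b ha hb => rw [map_add, map_add, ha, hb]

/-- On the side where `W ⊗ V` does not act, the two free evolutions cancel. The difference is
written as a sum so that `interleaved_add` applies. -/
theorem liouvillianAt_eq (s : ℝ) : M.liouvillianAt s =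
    TraceClass.conj (TensorProduct.mapL (M.Wt s) (M.Vt s)) 1 +
      -TraceClass.conj 1 (TensorProduct.mapL (M.Wt s) (M.Vt s)) := by
  have h := M.freeGroup_neg_comp s
  have h1 : (1 : HS ⊗[ℂ] HR →L[ℂ] HS ⊗[ℂ] HR) ∘L M.freeGroup s = M.freeGroup s := rfl
  have h2 : M.freeGroup (-s) ∘L (1 : HS ⊗[ℂ] HR →L[ℂ] HS ⊗[ℂ] HR) = M.freeGroup (-s) := rfl
  ext1 ρ
  simp only [liouvillianAt, liouvillian, freeEvolution, ContinuousLinearMap.comp_apply,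
    sub_apply, add_apply, neg_apply,
    map_sub, neg_neg, TraceClass.conj_conj]
  rw [M.freeGroup_conj, h1, h2, h, ← sub_eq_add_neg, ContinuousLinearMap.comp_assoc,
    M.freeGroup_conj]

theorem inner_Vt (z : ℝ) (x y : HR) : ⟪M.Vt z x, y⟫_ℂ = ⟪x, M.Vt z y⟫_ℂ :=
  M.groupR.inner_heisenberg (fun x y => by
    rw [← ContinuousLinearMap.adjoint_inner_right, M.V_selfAdjoint.adjoint_eq]) z x y

/-- `Ω` is invariant under the group because the generator annihilates it, so the one-point function
does not depend on time and equals `tr(V ω_R) = 0`. -/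
theorem inner_Ω_Vt_Ω (z : ℝ) : ⟪M.Ω, M.Vt z M.Ω⟫_ℂ = 0 := by
  have hΩ := M.groupR.op_apply_of_generator_eq_zero M.Ω_mem M.generator_Ω
  have h := M.trace_V
  rw [trace_conj_ketBra] at h
  simp only [Vt, UnitaryGroup.heisenberg, ContinuousLinearMap.comp_apply, hΩ]
  rw [← M.groupR.inner_op, hΩ, h]

/-- `V(τ k_r) ⋯ V(τ k_1) Ω_R` for a list `(k_1, …, k_r)`. -/
def excite {ι : Type*} (τ : ι → ℝ) (l : List ι) : HR := l.foldl (fun x k => M.Vt (τ k) x) M.Ω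

theorem excite_concat {ι : Type*} (τ : ι → ℝ) (l : List ι) (k : ι) :
    M.excite τ (l ++ [k]) = M.Vt (τ k) (M.excite τ l) := by
  simp [excite]

theorem excite_eq_prod {ι : Type*} (τ : ι → ℝ) (l : List ι) :
    M.excite τ l = (l.reverse.map fun k => M.Vt (τ k)).prod M.Ω := by
  induction l using List.reverseRecOn with
  | nil => rfl
  | append_singleton l k ih => simp [excite_concat, ih]

theorem inner_excite {ι : Type*} (τ : ι → ℝ) (l : List ι) (y : HR) :
    ⟪M.excite τ l, y⟫_ℂ = ⟪M.Ω, (l.map fun k => M.Vt (τ k)).prod y⟫_ℂ := by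
  induction l using List.reverseRecOn generalizing y with
  | nil => rfl
  | append_singleton l k ih => rw [excite_concat, inner_Vt, ih]; simp

/-- Moving symmetric operators to the left slot of the inner product reverses their order. Hence the
entries of `a^A` in `A` increase while the others decrease, although both vectors apply their
operators in the same order of time. -/
theorem correlation_rearrange {n : ℕ} (τ : Fin n → ℝ) (A : Finset (Fin n)) (l : List (Fin n)) :
    M.correlation τ (rearrange A l) =
      ⟪M.excite τ (l.filter (· ∈ A)), M.excite τ (l.filter (· ∉ A))⟫_ℂ := by
  rw [correlation, ω, trace_conj_ketBra, inner_excite, excite_eq_prod, rearrange]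
  simp

theorem continuous_excite {X ι : Type*} [TopologicalSpace X] {τ : X → ι → ℝ}
    (hτ : ∀ k, Continuous fun x => τ x k) (l : List ι) : Continuous fun x => M.excite (τ x) l := by
  induction l using List.reverseRecOn with
  | nil => exact continuous_const
  | append_singleton l k ih =>
    simp only [excite_concat, Vt, UnitaryGroup.heisenberg, ContinuousLinearMap.comp_apply]
    exact M.groupR.continuous_op_apply (hτ k).neg
      (M.V.continuous.comp (M.groupR.continuous_op_apply (hτ k) ih))

/-- The factor of `L_SR(τ k)` acting from the right for `k ∈ A` and from the left for `k ∉ A`. -/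
def oneSided (τ : ℕ → ℝ) (A : Finset ℕ) (k : ℕ) :
    TraceClass (HS ⊗[ℂ] HR) →L[ℂ] TraceClass (HS ⊗[ℂ] HR) :=
  if k ∈ A then -TraceClass.conj 1 (TensorProduct.mapL (M.Wt (τ k)) (M.Vt (τ k)))
  else TraceClass.conj (TensorProduct.mapL (M.Wt (τ k)) (M.Vt (τ k))) 1

/-- The system part of `oneSided`. -/
def oneSidedS (τ : ℕ → ℝ) (A : Finset ℕ) (k : ℕ) : TraceClass HS →L[ℂ] TraceClass HS :=
  if k ∈ A then -TraceClass.conj 1 (M.Wt (τ k)) else TraceClass.conj (M.Wt (τ k)) 1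

theorem norm_oneSidedS_le (τ : ℕ → ℝ) (A : Finset ℕ) (k : ℕ) : ‖M.oneSidedS τ A k‖ ≤ ‖M.W‖ := by
  have h1 : ‖(1 : HS →L[ℂ] HS)‖ ≤ 1 := ContinuousLinearMap.norm_id_le
  rw [oneSidedS]
  split_ifs
  · rw [norm_neg]
    refine (TraceClass.norm_conj_le _ _).trans ?_
    rw [norm_Wt]
    exact mul_le_of_le_one_left (norm_nonneg _) h1
  · refine (TraceClass.norm_conj_le _ _).trans ?_
    rw [norm_Wt]
    exact mul_le_of_le_one_right (norm_nonneg _) h1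

theorem norm_descProd_oneSidedS_le (τ : ℕ → ℝ) (A : Finset ℕ) (j i : ℕ) :
    ‖descProd (M.oneSidedS τ A) j i‖ ≤ ‖M.W‖ ^ i := by
  induction i with
  | zero => exact ContinuousLinearMap.norm_id_le.trans (pow_zero _).ge
  | succ i ih =>
    rw [descProd, pow_succ']
    exact (norm_mul_le _ _).trans
      (mul_le_mul (M.norm_oneSidedS_le τ A _) ih (norm_nonneg _) (norm_nonneg _))

theorem continuous_descProd_oneSidedS {X : Type*} [TopologicalSpace X] {τ : X → ℕ → ℝ}
    (hτ : ∀ k, Continuous fun x => τ x k) (A : Finset ℕ) (j i : ℕ) :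
    Continuous fun x => descProd (M.oneSidedS (τ x) A) j i := by
  have h : ∀ k, Continuous fun x => M.oneSidedS (τ x) A k := by
    intro k
    have hW := M.continuous_Wt.comp (hτ k)
    unfold oneSidedS
    split_ifs
    · exact ((TraceClass.continuous_conj_right _).comp hW).neg
    · exact (TraceClass.continuous_conj_left _).comp hW
  induction i with
  | zero => exact continuous_const
  | succ i ih => exact (h _).clm_comp ih

/-- The correlation function of the block of indices `j ≤ k < n`. -/
def blockCorrelation (τ : ℕ → ℝ) (A : Finset ℕ) (j n : ℕ) : ℂ :=
  ⟪M.excite τ ((List.range' j (n - j)).filter (· ∈ A)),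
    M.excite τ ((List.range' j (n - j)).filter (· ∉ A))⟫_ℂ

theorem blockCorrelation_succ (τ : ℕ → ℝ) (A : Finset ℕ) (j : ℕ) :
    M.blockCorrelation τ A j (j + 1) = 0 := by
  rw [blockCorrelation, Nat.add_sub_cancel_left]
  by_cases h : j ∈ A
  · simp only [excite, List.range'_one, List.filter_cons, h, List.filter_nil]
    simpa [M.inner_Vt] using M.inner_Ω_Vt_Ω (τ j)
  · simp only [excite, List.range'_one, List.filter_cons, h, List.filter_nil]
    simpa using M.inner_Ω_Vt_Ω (τ j)

theorem continuous_blockCorrelation {X : Type*} [TopologicalSpace X] {τ : X → ℕ → ℝ}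
    (hτ : ∀ k, Continuous fun x => τ x k) (A : Finset ℕ) (j n : ℕ) :
    Continuous fun x => M.blockCorrelation (τ x) A j n :=
  (M.continuous_excite hτ _).inner (M.continuous_excite hτ _)

/-- Left multiplications change only the ket and right multiplications only the bra of the reservoir
factor, while the system factor evolves on its own. The signs of the right multiplications are
carried by the system factor. -/
theorem descProd_oneSided_tensorState (τ : ℕ → ℝ) (A : Finset ℕ) (j i : ℕ) (σ : TraceClass HS) :
    descProd (M.oneSided τ A) j i (tensorState HS M.Ω σ) =
      tensorKetBra HS (M.excite τ ((List.range' j i).filter (· ∉ A)))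
        (M.excite τ ((List.range' j i).filter (· ∈ A)))
        (descProd (M.oneSidedS τ A) j i σ) := by
  induction i with
  | zero => rfl
  | succ i ih =>
    simp only [descProd, mul_apply_eq_comp]
    rw [ih, List.range'_1_concat, List.filter_append, List.filter_append, oneSided, oneSidedS]
    by_cases h : j + i ∈ A
    · simp only [h, if_true, neg_apply, map_neg,
        conj_mapL_right _ (M.inner_Vt _)]
      simp [h, excite_concat]
    · simp only [h, if_false, conj_mapL_left]
      simp [h, excite_concat]

theorem P_descProd (τ : ℕ → ℝ) (A : Finset ℕ) {j i n : ℕ} (hn : n = j + i) (σ : TraceClass HS) :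
    M.P (descProd (M.oneSided τ A) j i (tensorState HS M.Ω σ)) =
      M.blockCorrelation τ A j n • tensorState HS M.Ω (descProd (M.oneSidedS τ A) j i σ) := by
  subst hn
  rw [descProd_oneSided_tensorState, P, ContinuousLinearMap.comp_apply,
    partialTrace_tensorKetBra, map_smul, blockCorrelation, Nat.add_sub_cancel_left]

/-- Both sides satisfy the same recursion. Cutting at the last `P` leaves a block acting on a
product state, which yields one block correlation, and an earlier interleaved product, which is
covered by the induction hypothesis; the system factors recombine by `descProd_add`. -/
theorem P_interleaved (τ : ℕ → ℝ) (A : Finset ℕ) (n : ℕ) (σ : TraceClass HS) :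
    M.P (interleaved M.P (M.oneSided τ A) n (tensorState HS M.Ω σ)) =
      compositionSum (M.blockCorrelation τ A) (n + 1) •
        tensorState HS M.Ω (descProd (M.oneSidedS τ A) 0 (n + 1) σ) := by
  induction n using Nat.strong_induction_on with
  | _ n ih =>
    have h : ∀ i ∈ Finset.range n, M.P (descProd (M.oneSided τ A) (i + 1) (n - i)
          (M.P (interleaved M.P (M.oneSided τ A) i (tensorState HS M.Ω σ)))) =
        (M.blockCorrelation τ A (i + 1) (n + 1) *
          compositionSum (M.blockCorrelation τ A) (i + 1)) •
          tensorState HS M.Ω (descProd (M.oneSidedS τ A) 0 (n + 1) σ) := by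
      intro i hi
      have hi' := Finset.mem_range.1 hi
      have h1 := descProd_add (M.oneSidedS τ A) 0 (i + 1) (n - i)
      rw [show i + 1 + (n - i) = n + 1 by omega, zero_add] at h1
      rw [ih i hi', map_smul, map_smul, M.P_descProd τ A (n := n + 1) (by omega), smul_smul,
        mul_comm, h1]
      rfl
    rw [interleaved_eq]
    simp only [sub_apply, sum_apply, map_sub, map_sum,
      mul_apply_eq_comp]
    rw [Finset.sum_congr rfl h, ← Finset.sum_smul, M.P_descProd τ A (n := n + 1) (by omega),
      ← sub_smul]
    congr 1
    -- The term without any `P` is the missing term `j = 0` of the recursion.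
    rw [compositionSum_eq _ (Nat.succ_pos n), Finset.sum_range_succ', compositionSum_zero]
    ring

/-- The times `z_0, …, z_{n+1}`, extended by `0` to all indices. -/
def extendedTimes {n : ℕ} (z : Fin n → ℝ) (k : ℕ) : ℝ := if h : k < n then z ⟨k, h⟩ else 0

theorem extendedTimes_val {n : ℕ} (z : Fin n → ℝ) (k : Fin n) : extendedTimes z k = z k := by
  simp [extendedTimes]

theorem chain_eq (n : ℕ) (z : Fin (n + 1) → ℝ) (τ : ℕ → ℝ) (h : ∀ k : Fin (n + 1), τ k = z k) :
    M.chain n z = interleaved M.P (fun k => M.liouvillianAt (τ k)) n := by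
  induction n with
  | zero => simp [chain, interleaved, ← h]
  | succ n ih =>
    rw [chain, interleaved, ih (fun i => z i.castSucc) (fun k => h k.castSucc), ← h]
    rfl

theorem integrand_eq (n : ℕ) (z : Fin (n + 1) → ℝ) (τ : ℕ → ℝ)
    (hτ : ∀ k : Fin (n + 2), τ k = times z k) : M.integrand n z =
    ∑ A ∈ (Finset.range (n + 2)).powerset, compositionSum (M.blockCorrelation τ A) (n + 2) •
      (tensorState HS M.Ω ∘L descProd (M.oneSidedS τ A) 0 (n + 2) ∘L partialTrace HS HR) := by
  have h1 : M.chain (n + 1) (times z) = ∑ A ∈ (Finset.range (n + 2)).powerset,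
      interleaved M.P (M.oneSided τ A) (n + 1) := by
    rw [M.chain_eq _ _ τ hτ]
    simp only [liouvillianAt_eq]
    exact interleaved_add _ _ _ _
  ext1 ρ
  rw [integrand, h1]
  simp only [ContinuousLinearMap.comp_apply, sum_apply, map_sum]
  refine Finset.sum_congr rfl fun A _ => ?_
  have := M.P_interleaved τ A (n + 1) (partialTrace HS HR ρ)
  exact this

theorem blockCorrelation_eq {N : ℕ} (τ : ℕ → ℝ) (z : Fin N → ℝ) (hτ : ∀ k : Fin N, τ k = z k)
    (A : Finset ℕ) (d : Composition N) (s : Fin d.length) :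
    M.blockCorrelation τ A (d.sizeUpTo s) (d.sizeUpTo (s + 1)) =
      M.correlation z (rearrange (Finset.univ.filter fun k : Fin N => (k : ℕ) ∈ A) (block d s)) := by
  have h1 : (block d s).map Fin.val = List.range' (d.sizeUpTo s) (d.blocksFun s) := by
    refine List.ext_getElem (by simp [block]) fun i h1 h2 => ?_
    simp [block]
  have h2 : ∀ l : List (Fin N), M.excite τ (l.map Fin.val) = M.excite z l := by
    intro l
    simp only [excite, List.foldl_map, hτ]
  have h3 : d.sizeUpTo (s + 1) - d.sizeUpTo s = d.blocksFun s := by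
    rw [d.sizeUpTo_succ']; omega
  rw [correlation_rearrange, blockCorrelation, h3, ← h1, List.filter_map, List.filter_map, h2, h2]
  congr 3 <;> · funext k; simp

theorem compositionSum_eq_G (n : ℕ) (z : Fin (n + 1) → ℝ) (τ : ℕ → ℝ)
    (hτ : ∀ k : Fin (n + 2), τ k = times z k) (A : Finset ℕ) :
    compositionSum (M.blockCorrelation τ A) (n + 2) =
      M.G n (Finset.univ.filter fun k : Fin (n + 2) => (k : ℕ) ∈ A) z := by
  rw [compositionSum_eq_sum_contiguousPartitions (M.blockCorrelation_succ τ A), G]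
  simp only [M.blockCorrelation_eq τ (times z) hτ]

theorem norm_tensorState_comp_le (T : TraceClass HS →L[ℂ] TraceClass HS) :
    ‖tensorState HS M.Ω ∘L T ∘L partialTrace HS HR‖ ≤ ‖T‖ := by
  have h1 : ‖tensorState HS M.Ω‖ ≤ 1 := by simpa [M.norm_Ω] using norm_tensorState_le (HS := HS) M.Ω
  calc ‖tensorState HS M.Ω ∘L T ∘L partialTrace HS HR‖
      ≤ ‖tensorState HS M.Ω‖ * (‖T‖ * ‖partialTrace HS HR‖) :=
        (ContinuousLinearMap.opNorm_comp_le _ _).trans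
          (mul_le_mul_of_nonneg_left (ContinuousLinearMap.opNorm_comp_le _ _) (norm_nonneg _))
    _ ≤ 1 * (‖T‖ * 1) := by
        gcongr
        exact norm_partialTrace_le
    _ = ‖T‖ := by ring

/-- The integrand is bounded by the connected correlation functions. -/
theorem norm_integrand_le (n : ℕ) (z : Fin (n + 1) → ℝ) {B : ℝ} (hB : ∀ A, ‖M.G n A z‖ ≤ B) :
    ‖M.integrand n z‖ ≤ (2 * ‖M.W‖) ^ (n + 2) * B := by
  have hτ := extendedTimes_val (times z)
  rw [M.integrand_eq n z _ hτ]
  have hB0 : 0 ≤ B := (norm_nonneg _).trans (hB ∅)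
  calc _ ≤ ∑ A ∈ (Finset.range (n + 2)).powerset, B * ‖M.W‖ ^ (n + 2) := by
        refine norm_sum_le_of_le _ fun A _ => ?_
        rw [norm_smul, M.compositionSum_eq_G n z _ hτ]
        exact mul_le_mul (hB _) ((M.norm_tensorState_comp_le _).trans
          (M.norm_descProd_oneSidedS_le _ _ _ _)) (norm_nonneg _) hB0
    _ = (2 * ‖M.W‖) ^ (n + 2) * B := by
        rw [Finset.sum_const, Finset.card_powerset, Finset.card_range, nsmul_eq_mul, mul_pow]
        push_cast
        ring

/-- The reservoir group is only strongly continuous, so `L_SR(s)` need not be norm continuous. In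
the expanded integrand, however, the reservoir enters only through scalar correlation functions, and
the system factors are norm continuous because `H_S` is bounded. -/
theorem continuous_integrand (n : ℕ) : Continuous (M.integrand n) := by
  have hτ : ∀ k, Continuous fun z : Fin (n + 1) → ℝ => extendedTimes (times z) k := by
    intro k
    unfold extendedTimes
    split_ifs with h
    · have : Continuous fun z : Fin (n + 1) → ℝ => times z :=
        Continuous.finCons continuous_const continuous_id
      exact (continuous_apply _).comp this
    · exact continuous_const
  have h : M.integrand n = fun z => ∑ A ∈ (Finset.range (n + 2)).powerset,
      compositionSum (M.blockCorrelation (extendedTimes (times z)) A) (n + 2) •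
      (tensorState HS M.Ω ∘L descProd (M.oneSidedS (extendedTimes (times z)) A) 0 (n + 2) ∘L
        partialTrace HS HR) :=
    funext fun z => M.integrand_eq n z _ (extendedTimes_val (times z))
  rw [h]
  refine continuous_finsetSum _ fun A _ => Continuous.fun_smul ?_ ?_
  · unfold compositionSum
    refine continuous_finsetSum _ fun d _ => continuous_const.mul ?_
    exact continuous_finsetProd _ fun s _ => M.continuous_blockCorrelation hτ A _ _
  · exact continuous_const.clm_comp
      ((M.continuous_descProd_oneSidedS hτ A _ _).clm_comp continuous_const)

theorem integrableOn_integrand (n : ℕ) (t : ℝ) :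
    MeasureTheory.IntegrableOn (M.integrand n) (simplex (n + 1) t) := by
  have h : simplex (n + 1) t ⊆ Set.Icc (fun _ => 0) (fun _ => t) := fun z hz =>
    ⟨fun i => (hz.2 i).1, fun i => (hz.2 i).2⟩
  exact ((M.continuous_integrand n).continuousOn.integrableOn_compact isCompact_Icc).mono_set h

end Model

/-! ### Elementary inequalities and the constant `ξ` -/

section RealBounds

/-- Weighted AM-GM for `u / p` and `(t - u) / q` with weights proportional to `p` and `q`, raised to
the power `p + q`. The constant is the maximum of the left side, attained at `u = t p / (p + q)`. -/
theorem rpow_mul_rpow_le {p q u t : ℝ} (hp : 0 < p) (hq : 0 ≤ q) (hu : 0 ≤ u) (hut : u ≤ t) :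
    u ^ p * (t - u) ^ q ≤ t ^ (p + q) * (p ^ p * q ^ q / (p + q) ^ (p + q)) := by
  -- For `q = 0` the quotient `(t - u) / q` is meaningless, but the constant is `1` since `0 ^ 0 =
  -- 1`.
  rcases hq.eq_or_lt with rfl | hq'
  · simp only [Real.rpow_zero, mul_one, add_zero]
    rw [div_self (Real.rpow_pos_of_pos hp p).ne', mul_one]
    exact Real.rpow_le_rpow hu hut hp.le
  have hpq : 0 < p + q := by positivity
  have htu : 0 ≤ t - u := sub_nonneg.2 hut
  have h1 := Real.geom_mean_le_arith_mean2_weighted (w₁ := p / (p + q)) (w₂ := q / (p + q))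
    (p₁ := u / p) (p₂ := (t - u) / q) (by positivity) (by positivity) (by positivity)
    (by positivity) (by field_simp)
  have h2 : p / (p + q) * (u / p) + q / (p + q) * ((t - u) / q) = t / (p + q) := by
    field_simp; ring
  rw [h2] at h1
  have h3 := Real.rpow_le_rpow (by positivity) h1 hpq.le
  rw [Real.mul_rpow (by positivity) (by positivity), ← Real.rpow_mul (by positivity),
    ← Real.rpow_mul (by positivity), div_mul_cancel₀ _ hpq.ne', div_mul_cancel₀ _ hpq.ne',
    Real.div_rpow hu hp.le, Real.div_rpow htu hq, Real.div_rpow (hu.trans hut) hpq.le] at h3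
  have hpp : 0 < p ^ p := by positivity
  have hqq : 0 < q ^ q := by positivity
  calc u ^ p * (t - u) ^ q = u ^ p / p ^ p * ((t - u) ^ q / q ^ q) * (p ^ p * q ^ q) := by
        field_simp
    _ ≤ t ^ (p + q) / (p + q) ^ (p + q) * (p ^ p * q ^ q) := by gcongr
    _ = _ := by ring

/-- The element of the set defining `ξ` with `k - i - 1 = j`. -/
theorem le_ξ {m j : ℕ} {ε : ℝ} (hj : 1 ≤ j) (hjm : j ≤ m) :
    ((j : ℝ) - ε) ^ ((j : ℝ) - ε) * ((m : ℝ) - j) ^ ((m : ℝ) - j) /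
      (((m : ℝ) - ε) ^ ((m : ℝ) - ε) * (j.factorial : ℝ) * ((m - j).factorial : ℝ)) ≤ ξ m ε := by
  -- The expression depends on `k` and `i` only through `k - i - 1`, so `i = 0` may be taken.
  -- Boundedness holds because only finitely many pairs `(k, i)` occur.
  refine le_csSup ?_ ⟨j + 1, 0, by omega, by omega, ?_⟩
  · refine Set.Finite.bddAbove (Set.Finite.subset ((Set.finite_Iic (m + 1)).prod
      (Set.finite_Iic (m + 1)) |>.image fun x : ℕ × ℕ =>
        ((x.1 : ℝ) - x.2 - 1 - ε) ^ ((x.1 : ℝ) - x.2 - 1 - ε) *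
        ((m : ℝ) - x.1 + x.2 + 1) ^ ((m : ℝ) - x.1 + x.2 + 1) /
      (((m : ℝ) - ε) ^ ((m : ℝ) - ε) *
        ((x.1 - x.2 - 1).factorial : ℝ) * ((m + x.2 + 1 - x.1).factorial : ℝ))) ?_)
    rintro x ⟨k, i, hk, hi, rfl⟩
    exact ⟨(k, i), ⟨hk, show i ≤ m + 1 by omega⟩, rfl⟩
  · push_cast
    rw [show (j : ℝ) + 1 - 0 - 1 = j by ring, show (m : ℝ) - (j + 1) + 0 + 1 = m - j by ring]

/-- Only `u ^ ε` is split off from `u ^ j` and charged to the weight of `f`; the rest is maximised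
over `u`, which leaves `t ^ (m - ε)`. The condition `j ≥ 1` makes the exponent `j - ε` positive. -/
theorem pow_mul_pow_le_ξ {m j : ℕ} {ε u t : ℝ} (hε : 0 < ε) (hε1 : ε < 1) (hj : 1 ≤ j)
    (hjm : j ≤ m) (hu : 0 ≤ u) (hut : u ≤ t) (ht : 0 < t) :
    u ^ j / (j.factorial : ℝ) * ((t - u) ^ (m - j) / ((m - j).factorial : ℝ)) ≤
      (1 + |u|) ^ ε * (t ^ ((m : ℝ) - ε) * ξ m ε) := by
  have hj1 : (1 : ℝ) ≤ j := by exact_mod_cast hj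
  have hjm' : (j : ℝ) ≤ m := by exact_mod_cast hjm
  have hp : 0 < (j : ℝ) - ε := by linarith
  have h1 := rpow_mul_rpow_le hp (sub_nonneg.2 hjm') hu hut
  rw [show (j : ℝ) - ε + (m - j) = m - ε by ring] at h1
  have h2 : u ^ j = u ^ ε * u ^ ((j : ℝ) - ε) := by
    rw [← Real.rpow_add_of_nonneg hu hε.le hp.le, ← Real.rpow_natCast]; congr 1; ring
  have h3 : (t - u) ^ (m - j) = (t - u) ^ ((m : ℝ) - j) := by
    rw [← Real.rpow_natCast, Nat.cast_sub hjm]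
  have h4 : u ^ ε ≤ (1 + |u|) ^ ε :=
    Real.rpow_le_rpow hu (by rw [abs_of_nonneg hu]; linarith) hε.le
  have hξ := le_ξ (ε := ε) hj hjm
  have hm : 0 < (m : ℝ) - ε := by linarith
  have hfac : (0 : ℝ) < (j.factorial : ℝ) * ((m - j).factorial : ℝ) := by positivity
  calc u ^ j / (j.factorial : ℝ) * ((t - u) ^ (m - j) / ((m - j).factorial : ℝ))
      = u ^ ε * (u ^ ((j : ℝ) - ε) * (t - u) ^ ((m : ℝ) - j)) /
        ((j.factorial : ℝ) * ((m - j).factorial : ℝ)) := by rw [h2, h3]; field_simp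
    _ ≤ u ^ ε * (t ^ ((m : ℝ) - ε) * (((j : ℝ) - ε) ^ ((j : ℝ) - ε) *
          ((m : ℝ) - j) ^ ((m : ℝ) - j) / ((m : ℝ) - ε) ^ ((m : ℝ) - ε))) /
        ((j.factorial : ℝ) * ((m - j).factorial : ℝ)) := by gcongr
    _ = u ^ ε * (t ^ ((m : ℝ) - ε) * (((j : ℝ) - ε) ^ ((j : ℝ) - ε) *
          ((m : ℝ) - j) ^ ((m : ℝ) - j) / (((m : ℝ) - ε) ^ ((m : ℝ) - ε) *
          (j.factorial : ℝ) * ((m - j).factorial : ℝ)))) := by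
        have : 0 < ((m : ℝ) - ε) ^ ((m : ℝ) - ε) := by positivity
        field_simp
    _ ≤ _ := by gcongr

theorem ξ_nonneg {m : ℕ} {ε : ℝ} (hm : 1 ≤ m) (hε1 : ε < 1) : 0 ≤ ξ m ε := by
  have hm1 : (1 : ℝ) ≤ m := by exact_mod_cast hm
  refine le_trans ?_ (le_ξ (ε := ε) le_rfl hm)
  have h1 : 0 ≤ ((1 : ℕ) : ℝ) - ε := by push_cast; linarith
  have h2 : 0 ≤ (m : ℝ) - (1 : ℕ) := by push_cast; linarith
  have h3 : 0 ≤ (m : ℝ) - ε := by linarith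
  positivity

/-- The left side is a single term of the binomial expansion of the right side. -/
theorem pow_mul_pow_div_factorial_le {x y : ℝ} (hx : 0 ≤ x) (hy : 0 ≤ y) (r s : ℕ) :
    x ^ r / (r.factorial : ℝ) * (y ^ s / (s.factorial : ℝ)) ≤
      (x + y) ^ (r + s) / ((r + s).factorial : ℝ) := by
  have h1 : x ^ r * y ^ s * ((r + s).choose r : ℝ) ≤ (x + y) ^ (r + s) := by
    rw [add_pow]
    have := Finset.single_le_sum (f := fun k => x ^ k * y ^ (r + s - k) * ((r + s).choose k : ℝ))
      (s := Finset.range (r + s + 1)) (fun k _ => by positivity)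
      (Finset.mem_range.2 (by omega : r < r + s + 1))
    simpa using this
  have h2 : ((r + s).choose r : ℝ) * ((r.factorial : ℝ) * (s.factorial : ℝ)) =
      ((r + s).factorial : ℝ) := by
    have := Nat.choose_mul_factorial_mul_factorial (Nat.le_add_right r s)
    rw [Nat.add_sub_cancel_left] at this
    rw [← this]; push_cast; ring
  rw [div_mul_div_comm, div_le_div_iff₀ (by positivity) (by positivity), ← h2]
  calc x ^ r * y ^ s * (((r + s).choose r : ℝ) * ((r.factorial : ℝ) * (s.factorial : ℝ)))
      = x ^ r * y ^ s * ((r + s).choose r : ℝ) * ((r.factorial : ℝ) * (s.factorial : ℝ)) := by ring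
    _ ≤ _ := by gcongr

theorem hasDerivAt_pow_div_factorial (k : ℕ) (x : ℝ) :
    HasDerivAt (fun x : ℝ => x ^ (k + 1) / ((k + 1).factorial : ℝ)) (x ^ k / (k.factorial : ℝ)) x := by
  refine ((hasDerivAt_pow (k + 1) x).div_const ((k + 1).factorial : ℝ)).congr_deriv ?_
  rw [Nat.factorial_succ]
  push_cast
  field_simp

theorem integral_pow_div_factorial (a b : ℝ) (k : ℕ) :
    ∫ x in a..b, (x - a) ^ k / (k.factorial : ℝ) = (b - a) ^ (k + 1) / ((k + 1).factorial : ℝ) := by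
  have h : ∀ x ∈ Set.uIcc a b, HasDerivAt (fun x => (x - a) ^ (k + 1) / ((k + 1).factorial : ℝ))
      ((x - a) ^ k / (k.factorial : ℝ)) x := fun x _ =>
    (hasDerivAt_pow_div_factorial k (x - a)).comp_sub_const x a
  rw [intervalIntegral.integral_eq_sub_of_hasDerivAt h
    (Continuous.intervalIntegrable (by fun_prop) _ _)]
  simp

/-- A Beta integral: each integration by parts moves one power from `x` to `T - x`, and the boundary
terms vanish. -/
theorem integral_pow_mul_pow_div_factorial (T : ℝ) (r s : ℕ) :
    ∫ x in (0 : ℝ)..T, x ^ r / (r.factorial : ℝ) * ((T - x) ^ s / (s.factorial : ℝ)) =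
      T ^ (r + s + 1) / ((r + s + 1).factorial : ℝ) := by
  induction r generalizing s with
  | zero =>
    have := intervalIntegral.integral_comp_sub_left (a := 0) (b := T)
      (fun x => x ^ s / (s.factorial : ℝ)) T
    simp only [pow_zero, Nat.factorial_zero, Nat.cast_one, div_one, one_mul, zero_add]
    rw [this, sub_self, sub_zero]
    simpa using integral_pow_div_factorial 0 T s
  | succ r ih =>
    have hu : ∀ x ∈ Set.uIcc 0 T, HasDerivAt (fun x : ℝ => x ^ (r + 1) / ((r + 1).factorial : ℝ))
        (x ^ r / (r.factorial : ℝ)) x := fun x _ => hasDerivAt_pow_div_factorial r x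
    have hv : ∀ x ∈ Set.uIcc 0 T, HasDerivAt
        (fun x : ℝ => -((T - x) ^ (s + 1) / ((s + 1).factorial : ℝ)))
        ((T - x) ^ s / (s.factorial : ℝ)) x := by
      intro x _
      exact ((hasDerivAt_pow_div_factorial s (T - x)).comp_const_sub T x).fun_neg.congr_deriv
        (neg_neg _)
    rw [intervalIntegral.integral_mul_deriv_eq_deriv_mul hu hv
      (Continuous.intervalIntegrable (by fun_prop) _ _)
      (Continuous.intervalIntegrable (by fun_prop) _ _)]
    simp only [mul_neg, intervalIntegral.integral_neg, ih]
    simp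
    rw [show r + (s + 1) + 1 = r + 1 + s + 1 by ring]

end RealBounds

/-! ### Volumes of ordered tuples and marginal integrals -/

section OrderedVolume

open MeasureTheory ENNReal

/-- The volume `(b - a)^k / k!` of the ordered `k`-tuples in `[a, b]`. -/
def orderedVolume (a b : ℝ) (k : ℕ) : ℝ≥0∞ := ENNReal.ofReal ((b - a) ^ k / (k.factorial : ℝ))

@[fun_prop]
theorem measurable_orderedVolume {X : Type*} [MeasurableSpace X] {a b : X → ℝ} (ha : Measurable a)
    (hb : Measurable b) (k : ℕ) : Measurable fun x => orderedVolume (a x) (b x) k := by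
  unfold orderedVolume
  fun_prop

theorem setLIntegral_orderedVolume (a b : ℝ) (hab : a ≤ b) (k : ℕ) :
    ∫⁻ y in Set.Icc a b, orderedVolume a y k = orderedVolume a b (k + 1) := by
  unfold orderedVolume
  rw [← integral_pow_div_factorial, intervalIntegral.integral_of_le hab,
    ← integral_Icc_eq_integral_Ioc, ofReal_integral_eq_lintegral_ofReal]
  · exact Continuous.integrableOn_Icc (by fun_prop)
  · refine (ae_restrict_iff' measurableSet_Icc).2 (Filter.Eventually.of_forall fun y hy => ?_)
    have : 0 ≤ y - a := sub_nonneg.2 hy.1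
    simp only [Pi.zero_apply]
    positivity

theorem setLIntegral_orderedVolume_mul (T : ℝ) (hT : 0 ≤ T) (r s : ℕ) :
    ∫⁻ x in Set.Icc 0 T, orderedVolume 0 x r * orderedVolume x T s =
      orderedVolume 0 T (r + s + 1) := by
  unfold orderedVolume
  simp only [sub_zero]
  rw [← integral_pow_mul_pow_div_factorial, intervalIntegral.integral_of_le hT,
    ← integral_Icc_eq_integral_Ioc, ofReal_integral_eq_lintegral_ofReal]
  · refine setLIntegral_congr_fun measurableSet_Icc fun x hx => ?_
    rw [ENNReal.ofReal_mul]
    have := hx.1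
    positivity
  · exact Continuous.integrableOn_Icc (by fun_prop)
  · refine (ae_restrict_iff' measurableSet_Icc).2 (Filter.Eventually.of_forall fun y hy => ?_)
    have h1 : 0 ≤ T - y := sub_nonneg.2 hy.2
    have h2 := hy.1
    simp only [Pi.zero_apply]
    positivity

variable {δ : Type*} [DecidableEq δ]

/-- The indicator function of a proposition. -/
def ind (p : Prop) : ℝ≥0∞ := by classical exact if p then 1 else 0

theorem ind_of_true {p : Prop} (h : p) : ind p = 1 := if_pos h

theorem ind_of_false {p : Prop} (h : ¬p) : ind p = 0 := if_neg h

theorem ind_mono {p q : Prop} (h : p → q) : ind p ≤ ind q := by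
  by_cases hp : p
  · rw [ind_of_true hp, ind_of_true (h hp)]
  · rw [ind_of_false hp]; exact zero_le

theorem measurable_ind {X : Type*} [MeasurableSpace X] {p : X → Prop}
    (hp : MeasurableSet {x | p x}) : Measurable fun x => ind (p x) := by
  classical
  exact Measurable.ite hp measurable_const measurable_const

theorem ind_le_one (p : Prop) : ind p ≤ 1 := (ind_mono fun _ => trivial).trans_eq (ind_of_true trivial)

theorem lintegral_ind_mul {s : Set ℝ} (hs : MeasurableSet s) (f : ℝ → ℝ≥0∞) :
    ∫⁻ x, ind (x ∈ s) * f x = ∫⁻ x in s, f x := by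
  rw [← lintegral_indicator hs]
  refine lintegral_congr fun x => ?_
  by_cases h : x ∈ s
  · rw [ind_of_true h, one_mul, Set.indicator_of_mem h]
  · rw [ind_of_false h, zero_mul, Set.indicator_of_notMem h]

/-- The marginal at `x` sees only points that agree with `x` off `s`, so the comparison may use the
values of the frozen coordinates. -/
theorem lmarginal_mono_of_eqOn {s : Finset δ} {f g : (δ → ℝ) → ℝ≥0∞} {x : δ → ℝ}
    (h : ∀ z : δ → ℝ, (∀ i ∉ s, z i = x i) → f z ≤ g z) :
    (∫⋯∫⁻_s, f ∂fun _ => volume) x ≤ (∫⋯∫⁻_s, g ∂fun _ => volume) x :=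
  lintegral_mono fun y => h _ fun i hi => by simp [Function.updateFinset, hi]

theorem lmarginal_mul_le_of_eqOn {s : Finset δ} {f g : (δ → ℝ) → ℝ≥0∞} {x : δ → ℝ} {c : ℝ≥0∞}
    (hg : Measurable g) (h : ∀ z : δ → ℝ, (∀ i ∉ s, z i = x i) → f z ≤ c * g z) :
    (∫⋯∫⁻_s, f ∂fun _ => volume) x ≤ c * (∫⋯∫⁻_s, g ∂fun _ => volume) x := by
  refine (lmarginal_mono_of_eqOn h).trans_eq ?_
  exact lintegral_const_mul c (hg.comp measurable_updateFinset)

/-- Since no `r l` is integrated, each factor contains exactly one integration variable, and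
translation invariance of Lebesgue measure removes the shift by `z (r l)`. -/
theorem lmarginal_prod_differences {ι : Type*} [DecidableEq ι] (S : Finset ι) {r o : ι → δ}
    (ho : Set.InjOn o S) (hro : ∀ l ∈ S, ∀ l' ∈ S, r l ≠ o l') {g : ι → ℝ → ℝ≥0∞}
    (hg : ∀ l, Measurable (g l)) (x : δ → ℝ) :
    (∫⋯∫⁻_(S.image o), (fun z => ∏ l ∈ S, g l (z (o l) - z (r l))) ∂fun _ => volume) x ≤
      ∏ l ∈ S, ∫⁻ s, g l s := by
  induction S using Finset.induction_on generalizing x with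
  | empty => simp
  | insert l S hl ih =>
    have hm : ∀ S : Finset ι, Measurable fun z : δ → ℝ => ∏ l ∈ S, g l (z (o l) - z (r l)) :=
      fun S => Finset.measurable_prod _ fun l _ => (hg l).comp (by fun_prop)
    have hol : o l ∉ S.image o := by
      intro h
      obtain ⟨l', hl', he⟩ := Finset.mem_image.1 h
      have := ho (by simp [hl']) (by simp) he
      exact hl (this ▸ hl')
    rw [Finset.image_insert, lmarginal_insert _ (hm _) hol, Finset.prod_insert hl]
    have hrl : r l ∉ insert (o l) (S.image o) := by
      rw [← Finset.image_insert]
      intro h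
      obtain ⟨l', hl', he⟩ := Finset.mem_image.1 h
      exact hro l (by simp) l' hl' he.symm
    rw [Finset.mem_insert, not_or] at hrl
    calc _ ≤ ∫⁻ y, g l (y - x (r l)) * ∏ l ∈ S, ∫⁻ s, g l s := by
          refine lintegral_mono fun y => ?_
          refine (lmarginal_mul_le_of_eqOn (c := g l (y - x (r l))) (hm S) fun z hz => ?_).trans ?_
          · rw [Finset.prod_insert hl, hz _ hol, hz _ hrl.2, Function.update_self,
              Function.update_of_ne hrl.1]
          · gcongr
            exact ih (ho.mono (by simp)) (fun l hl l' hl' => hro l (by simp [hl]) l' (by simp [hl'])) _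
      _ = _ := by
          have hgl : Measurable fun y => g l (y - x (r l)) := (hg l).comp (by fun_prop)
          rw [lintegral_mul_const _ hgl, lintegral_sub_right_eq_self (g l)]

/-- The ordered tuples indexed by `s` with entries in `[a, b]`. -/
def orderedSet {δ : Type*} [LinearOrder δ] (s : Finset δ) (a b : ℝ) : Set (δ → ℝ) :=
  {z | MonotoneOn z s ∧ ∀ i ∈ s, a ≤ z i ∧ z i ≤ b}

theorem measurableSet_orderedSet {X δ : Type*} [MeasurableSpace X] [LinearOrder δ] [Countable δ]
    (s : Finset δ) {a b : X → ℝ} {z : X → δ → ℝ} (ha : Measurable a) (hb : Measurable b)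
    (hz : Measurable z) : MeasurableSet {x | z x ∈ orderedSet s (a x) (b x)} := by
  have hz' : ∀ i, Measurable fun x => z x i := fun i => (measurable_pi_apply i).comp hz
  have h : {x | z x ∈ orderedSet s (a x) (b x)} =
      (⋂ i ∈ s, ⋂ j ∈ s, ⋂ _ : i ≤ j, {x | z x i ≤ z x j}) ∩
        ⋂ i ∈ s, ({x | a x ≤ z x i} ∩ {x | z x i ≤ b x}) := by
    ext x
    simp only [orderedSet, MonotoneOn, Set.mem_inter_iff, Set.mem_iInter, Set.mem_ofPred_eq,
      Finset.mem_coe]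
  rw [h]
  refine MeasurableSet.inter ?_ ?_
  · refine MeasurableSet.biInter s.countable_toSet fun i _ =>
      MeasurableSet.biInter s.countable_toSet fun j _ => MeasurableSet.iInter fun _ => ?_
    exact measurableSet_le (hz' i) (hz' j)
  · refine MeasurableSet.biInter s.countable_toSet fun i _ => ?_
    exact (measurableSet_le ha (hz' i)).inter (measurableSet_le (hz' i) hb)

/-- The coordinate `y` of largest index is integrated last: for fixed `y` the others form an ordered
tuple in `[a, y]`, of volume at most `(y - a)^k / k!`. -/
theorem lmarginal_orderedSet_le {δ : Type*} [LinearOrder δ] [Countable δ] (s : Finset δ) (a b : ℝ)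
    (hab : a ≤ b) (x : δ → ℝ) :
    (∫⋯∫⁻_s, (fun z => ind (z ∈ orderedSet s a b)) ∂fun _ => volume) x ≤
      orderedVolume a b s.card := by
  have hm : ∀ (s : Finset δ) (b : ℝ), Measurable fun z => ind (z ∈ orderedSet s a b) := fun s b =>
    measurable_ind (measurableSet_orderedSet s measurable_const measurable_const measurable_id)
  induction s using Finset.induction_on_max generalizing b x with
  | empty => simpa [orderedVolume] using ind_le_one _
  | insert i s hi ih =>
    have his : i ∉ s := fun h => (hi i h).false
    rw [lmarginal_insert _ (hm _ b) his, Finset.card_insert_of_notMem his,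
      ← setLIntegral_orderedVolume a b hab, ← lintegral_ind_mul measurableSet_Icc]
    refine lintegral_mono fun y => ?_
    by_cases hy : y ∈ Set.Icc a b
    · rw [ind_of_true hy, one_mul]
      refine (lmarginal_mono_of_eqOn fun z hz => ?_).trans (ih y hy.1 _)
      refine ind_mono fun h => ⟨h.1.mono (by simp), fun k hk => ⟨(h.2 k (by simp [hk])).1, ?_⟩⟩
      have h1 := h.1 (by simp [hk] : k ∈ (↑(insert i s) : Set δ)) (by simp) (hi k hk).le
      rwa [hz i his, Function.update_self] at h1
    · rw [ind_of_false hy, zero_mul]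
      refine (lmarginal_mul_le_of_eqOn (c := 0) (g := 0) measurable_const fun z hz => ?_).trans (by simp)
      rw [ind_of_false fun h => hy ?_]
      · exact zero_le
      · have := h.2 i (by simp)
        rwa [hz i his, Function.update_self] at this

end OrderedVolume

/-! ### Integration with the distinguished pair held fixed -/

section InnerIntegral

open MeasureTheory ENNReal

variable {δ ι : Type*} [LinearOrder δ] [Fintype δ] [DecidableEq ι]

/-- The variables in `s'` are integrated first. There `f` is constant and the integral of `h` has a
bound independent of the remaining variables. -/
theorem lmarginal_union_mul_le {s s' : Finset δ} (hs : Disjoint s s') {f h : (δ → ℝ) → ℝ≥0∞}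
    (hf : Measurable f) (hh : Measurable h)
    (hind : ∀ z z' : δ → ℝ, (∀ i ∉ s', z i = z' i) → f z = f z') {C D : ℝ≥0∞}
    (hC : ∀ x, (∫⋯∫⁻_s, f ∂fun _ => volume) x ≤ C)
    (hD : ∀ x, (∫⋯∫⁻_s', h ∂fun _ => volume) x ≤ D) (x : δ → ℝ) :
    (∫⋯∫⁻_s ∪ s', (fun z => f z * h z) ∂fun _ => volume) x ≤ C * D := by
  have hfh : Measurable fun z => f z * h z := hf.mul hh
  rw [lmarginal_union _ _ hfh hs]
  calc _ ≤ (∫⋯∫⁻_s, (fun z => D * f z) ∂fun _ => volume) x := by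
        refine lmarginal_mono (fun z => ?_) x
        refine (lmarginal_mul_le_of_eqOn (c := f z) hh fun z' hz' => ?_).trans ?_
        · exact le_of_eq (by rw [hind z' z hz'])
        · rw [mul_comm]
          gcongr
          exact hD z
    _ ≤ D * (∫⋯∫⁻_s, f ∂fun _ => volume) x := lmarginal_mul_le_of_eqOn hf fun z _ => le_rfl
    _ ≤ C * D := by
        rw [mul_comm]
        gcongr
        exact hC x

theorem ind_orderedSet_congr {s s' : Finset δ} (hs : Disjoint s s') (a b : ℝ) {z z' : δ → ℝ}
    (h : ∀ i ∉ s', z i = z' i) : ind (z ∈ orderedSet s a b) = ind (z' ∈ orderedSet s a b) := by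
  have h' : ∀ i ∈ s, z i = z' i := fun i hi => h i (Finset.disjoint_left.1 hs hi)
  congr 1
  refine propext (and_congr ⟨fun hz => hz.congr h', fun hz => hz.congr fun i hi => (h' i hi).symm⟩ ?_)
  exact forall₂_congr fun i hi => by rw [h' i hi]

theorem filter_union_filter_union_filter {R : Finset δ} {a b : δ} (ha : a ∉ R)
    (hb : b ∉ R) : R.filter (· < a) ∪ (R.filter (fun i => a < i ∧ i < b) ∪
      R.filter (fun i => a < i ∧ b < i)) = R := by
  ext i
  simp only [Finset.mem_union, Finset.mem_filter]
  refine ⟨by tauto, fun hi => ?_⟩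
  have h1 : i ≠ a := fun h => ha (h ▸ hi)
  have h2 : i ≠ b := fun h => hb (h ▸ hi)
  rcases lt_or_gt_of_ne h1 with h | h
  · exact Or.inl ⟨hi, h⟩
  · rcases lt_or_gt_of_ne h2 with h' | h'
    · exact Or.inr (Or.inl ⟨hi, h, h'⟩)
    · exact Or.inr (Or.inr ⟨hi, h, h'⟩)

theorem disjoint_filter_lt {R : Finset δ} {a b : δ} :
    Disjoint (R.filter (· < a)) (R.filter (fun i => a < i ∧ i < b) ∪
      R.filter (fun i => a < i ∧ b < i)) := by
  rw [Finset.disjoint_left]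
  intro i hi hi'
  simp only [Finset.mem_union, Finset.mem_filter] at hi hi'
  rcases hi' with h | h
  · exact lt_asymm hi.2 h.2.1
  · exact lt_asymm hi.2 h.2.1

theorem disjoint_filter_between {R : Finset δ} {a b : δ} :
    Disjoint (R.filter (fun i => a < i ∧ i < b)) (R.filter (fun i => a < i ∧ b < i)) := by
  rw [Finset.disjoint_left]
  intro i hi hi'
  simp only [Finset.mem_filter] at hi hi'
  exact lt_asymm hi.2.2 hi'.2.2

theorem card_filter_add_card_filter_add_card_filter {R : Finset δ} {a b : δ} (ha : a ∉ R)
    (hb : b ∉ R) : (R.filter (· < a)).card + ((R.filter (fun i => a < i ∧ i < b)).card +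
      (R.filter (fun i => a < i ∧ b < i)).card) = R.card := by
  rw [← Finset.card_union_of_disjoint disjoint_filter_between,
    ← Finset.card_union_of_disjoint disjoint_filter_lt, filter_union_filter_union_filter ha hb]

theorem measurable_ind_orderedSet (s : Finset δ) (a b : ℝ) :
    Measurable fun z : δ → ℝ => ind (z ∈ orderedSet s a b) :=
  measurable_ind (measurableSet_orderedSet s measurable_const measurable_const measurable_id)

/-- The integral over the times in `R` and over the times `o l`, `l ∈ S`, for fixed values of the
times `a` and `b`. -/
theorem lmarginal_orderedSet_mul_prod_le {t : ℝ} {a b : δ} (hab : a < b) {R : Finset δ}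
    (haR : a ∉ R) (hbR : b ∉ R) {S : Finset ι} {r o : ι → δ} (ho : Set.InjOn o S)
    (hro : ∀ l ∈ S, ∀ l' ∈ S, r l ≠ o l') (hRS : Disjoint R (S.image o)) (haS : a ∉ S.image o)
    (hbS : b ∉ S.image o) {g : ι → ℝ → ℝ≥0∞} (hg : ∀ l, Measurable (g l)) (x : δ → ℝ) :
    (∫⋯∫⁻_R ∪ S.image o, (fun z => ind (z ∈ orderedSet Finset.univ 0 t) *
        ∏ l ∈ S, g l (z (o l) - z (r l))) ∂fun _ => volume) x ≤
      ind (0 ≤ x a ∧ x a ≤ x b ∧ x b ≤ t) *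
        (orderedVolume 0 (x a) (R.filter (· < a)).card *
          (orderedVolume (x a) (x b) (R.filter (fun i => a < i ∧ i < b)).card *
            orderedVolume (x b) t (R.filter (fun i => a < i ∧ b < i)).card) *
          ∏ l ∈ S, ∫⁻ s, g l s) := by
  have hm : Measurable fun z : δ → ℝ => ∏ l ∈ S, g l (z (o l) - z (r l)) :=
    Finset.measurable_prod _ fun l _ => (hg l).comp (by fun_prop)
  have ha' : a ∉ R ∪ S.image o := by simp [haR, Finset.mem_image] at haS ⊢; exact haS
  have hb' : b ∉ R ∪ S.image o := by simp [hbR, Finset.mem_image] at hbS ⊢; exact hbS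
  by_cases hx : 0 ≤ x a ∧ x a ≤ x b ∧ x b ≤ t
  · rw [ind_of_true hx, one_mul]
    have hR := filter_union_filter_union_filter haR hbR
    set A := R.filter (· < a) with hA
    set B := R.filter (fun i => a < i ∧ i < b) with hB
    set D := R.filter (fun i => a < i ∧ b < i) with hD
    have hAI := measurable_ind_orderedSet A 0 (x a)
    have hBI := measurable_ind_orderedSet B (x a) (x b)
    have hDI := measurable_ind_orderedSet D (x b) t
    have hAR : Disjoint A (B ∪ D) := disjoint_filter_lt
    have hBD : Disjoint B D := disjoint_filter_between
    -- The simplex is enlarged: among the times in `R`, only the order within each of the three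
    -- groups below, between and above `a` and `b` is kept, and the times `o l` lose every
    -- constraint. The integrand then factorises.
    calc _ ≤ (∫⋯∫⁻_R ∪ S.image o, (fun z => (ind (z ∈ orderedSet A 0 (x a)) *
            (ind (z ∈ orderedSet B (x a) (x b)) * ind (z ∈ orderedSet D (x b) t))) *
            ∏ l ∈ S, g l (z (o l) - z (r l))) ∂fun _ => volume) x := by
          refine lmarginal_mono_of_eqOn fun z hz => mul_le_mul_left ?_ _
          by_cases h : z ∈ orderedSet Finset.univ 0 t
          · have hmono : Monotone z := by simpa [MonotoneOn, Monotone] using h.1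
            have h2 : ∀ i, 0 ≤ z i ∧ z i ≤ t := fun i => h.2 i (Finset.mem_univ i)
            have hza := hz a ha'
            have hzb := hz b hb'
            rw [ind_of_true (p := z ∈ orderedSet A 0 (x a)),
              ind_of_true (p := z ∈ orderedSet B (x a) (x b)),
              ind_of_true (p := z ∈ orderedSet D (x b) t), one_mul, one_mul]
            · exact ind_le_one _
            · refine ⟨hmono.monotoneOn _, fun i hi => ⟨?_, (h2 i).2⟩⟩
              rw [← hzb]
              exact hmono (Finset.mem_filter.1 hi).2.2.le
            · refine ⟨hmono.monotoneOn _, fun i hi => ?_⟩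
              rw [← hza, ← hzb]
              exact ⟨hmono (Finset.mem_filter.1 hi).2.1.le, hmono (Finset.mem_filter.1 hi).2.2.le⟩
            · refine ⟨hmono.monotoneOn _, fun i hi => ⟨(h2 i).1, ?_⟩⟩
              rw [← hza]
              exact hmono (Finset.mem_filter.1 hi).2.le
          · rw [ind_of_false h]; exact zero_le
      _ ≤ _ := by
          refine lmarginal_union_mul_le hRS (hAI.mul (hBI.mul hDI)) hm ?_ ?_
            (lmarginal_prod_differences S ho hro hg) x
          · intro z z' hz
            rw [← hR, Finset.disjoint_union_left, Finset.disjoint_union_left] at hRS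
            simp only [Pi.mul_apply]
            rw [ind_orderedSet_congr hRS.1 _ _ hz, ind_orderedSet_congr hRS.2.1 _ _ hz,
              ind_orderedSet_congr hRS.2.2 _ _ hz]
          · rw [← hR]
            refine lmarginal_union_mul_le hAR hAI (hBI.mul hDI)
              (fun z z' hz => ind_orderedSet_congr hAR _ _ hz)
              (lmarginal_orderedSet_le _ _ _ hx.1) ?_
            exact lmarginal_union_mul_le hBD hBI hDI
              (fun z z' hz => ind_orderedSet_congr hBD _ _ hz)
              (lmarginal_orderedSet_le _ _ _ hx.2.1) (lmarginal_orderedSet_le _ _ _ hx.2.2)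
  · rw [ind_of_false hx, zero_mul]
    -- If the fixed times violate the order, no point of the simplex has these coordinates and the
    -- integrand vanishes.
    refine (lmarginal_mul_le_of_eqOn (c := 0) (g := 0) measurable_const fun z hz => ?_).trans
      (by simp)
    rw [ind_of_false, zero_mul]
    · exact zero_le
    · intro h
      have hmono : Monotone z := by simpa [MonotoneOn, Monotone] using h.1
      have h2 : ∀ i, 0 ≤ z i ∧ z i ≤ t := fun i => h.2 i (Finset.mem_univ i)
      refine hx ?_
      rw [← hz a ha', ← hz b hb']
      exact ⟨(h2 a).1, hmono hab.le, (h2 b).2⟩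

end InnerIntegral

/-! ### Integration over the distinguished pair -/

section OuterIntegral

open MeasureTheory ENNReal

theorem orderedVolume_zero_right (a b : ℝ) : orderedVolume a b 0 = 1 := by simp [orderedVolume]

theorem orderedVolume_congr {a b a' b' : ℝ} (h : b - a = b' - a') (k : ℕ) :
    orderedVolume a b k = orderedVolume a' b' k := by
  rw [orderedVolume, orderedVolume, h]

theorem lintegral_lintegral_shift {F : ℝ → ℝ → ℝ≥0∞} (hF : Measurable (Function.uncurry F)) :
    ∫⁻ x, ∫⁻ y, F x y = ∫⁻ u, ∫⁻ x, F x (x + u) := by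
  have h : ∀ x, ∫⁻ y, F x y = ∫⁻ u, F x (x + u) := fun x =>
    (lintegral_add_left_eq_self (F x) x).symm
  simp only [h]
  exact lintegral_lintegral_swap
    (hF.comp (measurable_fst.prodMk (measurable_fst.add measurable_snd))).aemeasurable

theorem measurable_ind_between (t : ℝ) :
    Measurable fun x : ℝ × ℝ => ind (0 ≤ x.1 ∧ x.1 ≤ x.2 ∧ x.2 ≤ t) := by
  refine measurable_ind ?_
  exact (measurableSet_le measurable_const measurable_fst).inter
    ((measurableSet_le measurable_fst measurable_snd).inter
      (measurableSet_le measurable_snd measurable_const))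

/-- With `u = y - x` fixed, the pair slides along `[0, t - u]`, and the Beta integral of the volumes
to its left and right yields `(t - u)^(p+q+1)`. The additional power comes from this sliding. -/
theorem lintegral_pair_le {g : ℝ → ℝ≥0∞} (hg : Measurable g) (t : ℝ) (p j q : ℕ) :
    ∫⁻ x, ∫⁻ y, g (y - x) * (ind (0 ≤ x ∧ x ≤ y ∧ y ≤ t) *
        (orderedVolume 0 x p * (orderedVolume x y j * orderedVolume y t q))) ≤
      ∫⁻ u, g u * (ind (0 ≤ u ∧ u ≤ t) *
        (orderedVolume 0 u j * orderedVolume u t (p + q + 1))) := by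
  have hmeas : Measurable (Function.uncurry fun x y : ℝ => g (y - x) *
      (ind (0 ≤ x ∧ x ≤ y ∧ y ≤ t) *
        (orderedVolume 0 x p * (orderedVolume x y j * orderedVolume y t q)))) := by
    have h1 := measurable_ind_between t
    refine (hg.comp (measurable_snd.sub measurable_fst)).mul (h1.mul ?_)
    fun_prop
  rw [lintegral_lintegral_shift hmeas]
  refine lintegral_mono fun u => ?_
  by_cases hu : 0 ≤ u ∧ u ≤ t
  · have hint : Measurable fun x : ℝ => ind (x ∈ Set.Icc 0 (t - u)) *
        (orderedVolume 0 x p * orderedVolume x (t - u) q) :=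
      (measurable_ind measurableSet_Icc).mul (by fun_prop)
    calc _ ≤ ∫⁻ x, (g u * orderedVolume 0 u j) * (ind (x ∈ Set.Icc 0 (t - u)) *
          (orderedVolume 0 x p * orderedVolume x (t - u) q)) := by
          refine lintegral_mono fun x => ?_
          simp only
          rw [add_sub_cancel_left, orderedVolume_congr (show x + u - x = u - 0 by ring),
            orderedVolume_congr (show t - (x + u) = t - u - x by ring)]
          have h : ind (0 ≤ x ∧ x ≤ x + u ∧ x + u ≤ t) ≤ ind (x ∈ Set.Icc 0 (t - u)) :=
            ind_mono fun h => ⟨h.1, by linarith [h.2.2]⟩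
          calc _ ≤ g u * (ind (x ∈ Set.Icc 0 (t - u)) * (orderedVolume 0 x p *
                (orderedVolume 0 u j * orderedVolume x (t - u) q))) := by gcongr
            _ = _ := by ring
      _ = _ := by
          rw [lintegral_const_mul _ hint, lintegral_ind_mul measurableSet_Icc,
            setLIntegral_orderedVolume_mul _ (sub_nonneg.2 hu.2), ind_of_true hu,
            orderedVolume_congr (show t - u - 0 = t - u by ring)]
          ring
  · rw [ind_of_false hu]
    refine le_of_eq ?_
    rw [zero_mul, mul_zero]
    rw [lintegral_eq_zero_iff' (by
      exact (hmeas.comp ((measurable_id).prodMk (measurable_id.add_const u))).aemeasurable)]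
    refine Filter.Eventually.of_forall fun x => ?_
    simp only [Pi.zero_apply]
    rw [ind_of_false, zero_mul, mul_zero]
    exact fun h => hu ⟨by linarith [h.2.1], by linarith [h.2.2, h.1]⟩

theorem orderedVolume_mul_le {a b c d : ℝ} (hab : a ≤ b) (hcd : c ≤ d) (p q : ℕ) :
    orderedVolume a b p * orderedVolume c d q ≤ orderedVolume 0 (b - a + (d - c)) (p + q) := by
  have h1 := sub_nonneg.2 hab
  have h2 := sub_nonneg.2 hcd
  unfold orderedVolume
  rw [← ENNReal.ofReal_mul (by positivity), sub_zero]
  exact ENNReal.ofReal_le_ofReal (pow_mul_pow_div_factorial_le h1 h2 p q)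

theorem measurable_pair_through {g : ℝ → ℝ≥0∞} (hg : Measurable g) (t v : ℝ) (p q : ℕ) :
    Measurable (Function.uncurry fun x y : ℝ => g (y - x) * (ind (x ≤ v ∧ v ≤ y) *
      (ind (0 ≤ x ∧ x ≤ y ∧ y ≤ t) *
        (orderedVolume 0 x p * (orderedVolume x y 0 * orderedVolume y t q))))) := by
  have h1 := measurable_ind_between t
  have h2 : Measurable fun x : ℝ × ℝ => ind (x.1 ≤ v ∧ v ≤ x.2) :=
    measurable_ind ((measurableSet_le measurable_fst measurable_const).inter
      (measurableSet_le measurable_const measurable_snd))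
  refine (hg.comp (measurable_snd.sub measurable_fst)).mul (h2.mul (h1.mul ?_))
  fun_prop

/-- A pair at distance `u` that encloses `v` has its left end in `[v - u, v]`. The length of this
interval supplies the power of `u` that no retained time provides; the volumes outside the pair are
bounded uniformly in its position by `orderedVolume_mul_le`. -/
theorem lintegral_pair_through_le {g : ℝ → ℝ≥0∞} (hg : Measurable g) (t v : ℝ) (p q : ℕ) :
    ∫⁻ x, ∫⁻ y, g (y - x) * (ind (x ≤ v ∧ v ≤ y) * (ind (0 ≤ x ∧ x ≤ y ∧ y ≤ t) *
        (orderedVolume 0 x p * (orderedVolume x y 0 * orderedVolume y t q)))) ≤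
      ∫⁻ u, g u * (ind (0 ≤ u ∧ u ≤ t) *
        (orderedVolume 0 u 1 * orderedVolume u t (p + q))) := by
  rw [lintegral_lintegral_shift (measurable_pair_through hg t v p q)]
  refine lintegral_mono fun u => ?_
  calc _ ≤ ∫⁻ x, (g u * (ind (0 ≤ u ∧ u ≤ t) * orderedVolume u t (p + q))) *
        (ind (x ∈ Set.Icc (v - u) v) * 1) := by
        refine lintegral_mono fun x => ?_
        simp only
        by_cases h : 0 ≤ x ∧ x ≤ x + u ∧ x + u ≤ t
        · have hu : 0 ≤ u ∧ u ≤ t := ⟨by linarith [h.2.1], by linarith [h.2.2, h.1]⟩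
          rw [ind_of_true h, ind_of_true hu, add_sub_cancel_left, orderedVolume_zero_right,
            one_mul, one_mul, one_mul, mul_one, mul_assoc, mul_comm (orderedVolume u t _)]
          have h1 := orderedVolume_mul_le h.1 h.2.2 p q
          rw [orderedVolume_congr (show x - 0 + (t - (x + u)) - 0 = t - u by ring)] at h1
          have h2 : ind (x ≤ v ∧ v ≤ x + u) ≤ ind (x ∈ Set.Icc (v - u) v) :=
            ind_mono fun h => ⟨by linarith [h.2], h.1⟩
          gcongr
        · rw [ind_of_false h]
          simp
    _ = _ := by
        have hI : Measurable fun x => ind (x ∈ Set.Icc (v - u) v) * 1 :=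
          (measurable_ind measurableSet_Icc).mul_const _
        rw [lintegral_const_mul _ hI, lintegral_ind_mul measurableSet_Icc, setLIntegral_one, Real.volume_Icc,
          show orderedVolume 0 u 1 = ENNReal.ofReal (v - (v - u)) by simp [orderedVolume]]
        ring

end OuterIntegral

/-! ### Pairings of the times and the three positions of the time `0` -/

section Pairings

open MeasureTheory ENNReal

/-- A pairing of the indices `0, …, 2m+1`: each index is either `r l` or `o l` for exactly one `l`,
and `r l` is paired with `o l`. The pair of index `0` satisfies `r 0 < o 0`. -/
structure Pairing (m : ℕ) where
  r : Fin (m + 1) → Fin (2 * m + 2)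
  o : Fin (m + 1) → Fin (2 * m + 2)
  bijective : Function.Bijective (Sum.elim r o)
  lt : r 0 < o 0

namespace Pairing

variable {m : ℕ} (π : Pairing m)

theorem r_injective : Function.Injective π.r := fun l l' h => by
  simpa using π.bijective.1 (a₁ := Sum.inl l) (a₂ := Sum.inl l') h

theorem o_injective : Function.Injective π.o := fun l l' h => by
  simpa using π.bijective.1 (a₁ := Sum.inr l) (a₂ := Sum.inr l') h

theorem r_ne_o (l l' : Fin (m + 1)) : π.r l ≠ π.o l' := fun h => by
  simpa using π.bijective.1 (a₁ := Sum.inl l) (a₂ := Sum.inr l') h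

theorem exists_eq (i : Fin (2 * m + 2)) : (∃ l, π.r l = i) ∨ ∃ l, π.o l = i := by
  obtain ⟨l | l, h⟩ := π.bijective.2 i
  · exact Or.inl ⟨l, h⟩
  · exact Or.inr ⟨l, h⟩

theorem disjoint_image (S S' : Finset (Fin (m + 1))) :
    Disjoint (S.image π.r) (S'.image π.o) := by
  rw [Finset.disjoint_left]
  intro i hi hi'
  obtain ⟨l, -, rfl⟩ := Finset.mem_image.1 hi
  obtain ⟨l', -, h⟩ := Finset.mem_image.1 hi'
  exact π.r_ne_o _ _ h.symm

theorem r_mem_image {S : Finset (Fin (m + 1))} {l : Fin (m + 1)} : π.r l ∈ S.image π.r ↔ l ∈ S :=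
  π.r_injective.mem_finset_image

theorem o_mem_image {S : Finset (Fin (m + 1))} {l : Fin (m + 1)} : π.o l ∈ S.image π.o ↔ l ∈ S :=
  π.o_injective.mem_finset_image

theorem r_notMem_image (S : Finset (Fin (m + 1))) (l : Fin (m + 1)) : π.r l ∉ S.image π.o := by
  intro h
  obtain ⟨l', -, h⟩ := Finset.mem_image.1 h
  exact π.r_ne_o _ _ h.symm

theorem o_notMem_image (S : Finset (Fin (m + 1))) (l : Fin (m + 1)) : π.o l ∉ S.image π.r := by
  intro h
  obtain ⟨l', -, h⟩ := Finset.mem_image.1 h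
  exact π.r_ne_o _ _ h

/-- The product of the pair functions on the simplex. -/
def weight (g : Fin (m + 1) → ℝ → ℝ≥0∞) (t : ℝ) (z : Fin (2 * m + 2) → ℝ) : ℝ≥0∞ :=
  ind (z ∈ orderedSet Finset.univ 0 t) * ∏ l, g l (z (π.o l) - z (π.r l))

variable {g : Fin (m + 1) → ℝ → ℝ≥0∞} (hg : ∀ l, Measurable (g l)) {Γ : ℝ≥0∞}
  (hΓ : ∀ l, ∫⁻ s, g l s = Γ) {t : ℝ} {κ : ℝ → ℝ≥0∞} (hκm : Measurable κ)
  (hκ : ∀ j u, 1 ≤ j → j ≤ m → 0 ≤ u → u ≤ t →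
    orderedVolume 0 u j * orderedVolume u t (m - j) ≤ κ u)

include hg in
theorem measurable_weight : Measurable (π.weight g t) :=
  (measurable_ind_orderedSet _ _ _).mul
    (Finset.measurable_prod _ fun l _ => (hg l).comp (by fun_prop))

include hκ in
theorem ind_mul_orderedVolume_le {j k : ℕ} (hj : 1 ≤ j) (hk : j + k = m) (u : ℝ) :
    ind (0 ≤ u ∧ u ≤ t) * (orderedVolume 0 u j * orderedVolume u t k) ≤ κ u := by
  by_cases hu : 0 ≤ u ∧ u ≤ t
  · rw [ind_of_true hu, one_mul, show k = m - j by omega]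
    exact hκ j u hj (by omega) hu.1 hu.2
  · rw [ind_of_false hu, zero_mul]; exact zero_le

include hg in
/-- The integral over all times but those of index `r 0` and `o 0`, those of index `r l` with
`l ∉ S` and those of index `o l` with `l ∉ S'`. -/
theorem lmarginal_weight_le {S S' : Finset (Fin (m + 1))} (hS : 0 ∉ S) (hS' : 0 ∉ S')
    {c : ℝ≥0∞} (x : Fin (2 * m + 2) → ℝ)
    (hc : ∀ z ∈ orderedSet Finset.univ 0 t, (∀ i ∉ S.image π.r ∪ S'.image π.o, z i = x i) →
      ∏ l ∈ (Finset.univ.erase 0) \ S', g l (z (π.o l) - z (π.r l)) ≤ c)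
    (hΓ : ∀ l, ∫⁻ s, g l s = Γ) :
    (∫⋯∫⁻_S.image π.r ∪ S'.image π.o, π.weight g t ∂fun _ => volume) x ≤
      g 0 (x (π.o 0) - x (π.r 0)) * c *
      (ind (0 ≤ x (π.r 0) ∧ x (π.r 0) ≤ x (π.o 0) ∧ x (π.o 0) ≤ t) *
        (orderedVolume 0 (x (π.r 0)) ((S.image π.r).filter (· < π.r 0)).card *
          (orderedVolume (x (π.r 0)) (x (π.o 0))
              ((S.image π.r).filter (fun i => π.r 0 < i ∧ i < π.o 0)).card *
            orderedVolume (x (π.o 0)) t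
              ((S.image π.r).filter (fun i => π.r 0 < i ∧ π.o 0 < i)).card) *
          Γ ^ S'.card)) := by
  have ha1 : π.r 0 ∉ S.image π.r := fun h => hS (π.r_mem_image.1 h)
  have hb1 : π.o 0 ∉ S'.image π.o := fun h => hS' (π.o_mem_image.1 h)
  have hmain := lmarginal_orderedSet_mul_prod_le (t := t) π.lt ha1 (π.o_notMem_image S 0)
    (π.o_injective.injOn (s := S')) (fun l _ l' _ => π.r_ne_o l l') (π.disjoint_image S S')
    (π.r_notMem_image S' 0) hb1 hg x
  rw [Finset.prod_congr rfl fun l _ => hΓ l, Finset.prod_const] at hmain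
  have hm : Measurable fun z : Fin (2 * m + 2) → ℝ => ind (z ∈ orderedSet Finset.univ 0 t) *
      ∏ l ∈ S', g l (z (π.o l) - z (π.r l)) := (measurable_ind_orderedSet _ _ _).mul
    (Finset.measurable_prod _ fun l _ => (hg l).comp (by fun_prop))
  refine (lmarginal_mul_le_of_eqOn (c := g 0 (x (π.o 0) - x (π.r 0)) * c) hm
    fun z hz => ?_).trans (mul_le_mul_right hmain _)
  by_cases h : z ∈ orderedSet Finset.univ 0 t
  · have hsub : S' ⊆ Finset.univ.erase 0 := fun l hl =>
      Finset.mem_erase.2 ⟨fun h => hS' (h ▸ hl), Finset.mem_univ _⟩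
    have h1 : z (π.o 0) = x (π.o 0) := hz _ (by
      rw [Finset.mem_union, not_or]; exact ⟨π.o_notMem_image S 0, hb1⟩)
    have h2 : z (π.r 0) = x (π.r 0) := hz _ (by
      rw [Finset.mem_union, not_or]; exact ⟨ha1, π.r_notMem_image S' 0⟩)
    rw [weight, ind_of_true h, one_mul, one_mul, ← Finset.mul_prod_erase _ _ (Finset.mem_univ 0),
      ← Finset.prod_sdiff hsub, h1, h2, mul_assoc]
    gcongr
    exact hc z h hz
  · rw [weight, ind_of_false h, zero_mul]; exact zero_le

include hg hΓ hκm hκ in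
/-- The integral of the weight if the time `0` belongs to the pair of index `0`. -/
theorem lmarginal_weight_le_of_r_zero_eq (h0 : π.r 0 = 0)
    (hin : ∃ l, π.r 0 < π.r l ∧ π.r l < π.o 0) :
    (∫⋯∫⁻_Finset.univ.erase 0, π.weight g t ∂fun _ => volume) (fun _ => 0) ≤
      Γ ^ m * ∫⁻ u, g 0 u * κ u := by
  set S : Finset (Fin (m + 1)) := Finset.univ.erase 0 with hS
  have h0S : (0 : Fin (m + 1)) ∉ S := Finset.notMem_erase _ _
  have hb : π.o 0 ∉ S.image π.r ∪ S.image π.o := by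
    rw [Finset.mem_union, not_or]
    exact ⟨π.o_notMem_image S 0, fun h => h0S (π.o_mem_image.1 h)⟩
  -- As `0 = r 0` is frozen, the integration variables are `o 0` and both times of each other pair.
  have hT : Finset.univ.erase 0 = insert (π.o 0) (S.image π.r ∪ S.image π.o) := by
    ext i
    simp only [Finset.mem_erase, Finset.mem_univ, and_true, Finset.mem_insert, Finset.mem_union]
    rcases π.exists_eq i with ⟨l, rfl⟩ | ⟨l, rfl⟩
    · have h1 : π.r l ≠ 0 ↔ l ∈ S := by
        rw [← h0, π.r_injective.ne_iff, hS]; simp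
      have h2 := π.r_ne_o l 0
      have h3 := π.r_notMem_image S l
      have h4 := π.r_mem_image (S := S) (l := l)
      tauto
    · have h1 : π.o l ≠ 0 := by rw [← h0]; exact (π.r_ne_o _ _).symm
      have h2 : l = 0 ∨ l ∈ S := by rw [hS]; simp [em]
      have h3 := π.o_mem_image (S := S) (l := l)
      rcases h2 with rfl | h2
      · simp [h1]
      · tauto
  have hcS : S.card = m := by rw [hS]; simp
  have hcard := card_filter_add_card_filter_add_card_filter (R := S.image π.r)
    (fun h => h0S (π.r_mem_image.1 h)) (π.o_notMem_image S 0)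
  rw [Finset.card_image_of_injective _ π.r_injective, hcS] at hcard
  have hA : (S.image π.r).filter (· < π.r 0) = ∅ := by
    rw [h0]; simp
  -- The retained time in the gap makes the exponent `j` of `u` at least one.
  have hB : 1 ≤ ((S.image π.r).filter (fun i => π.r 0 < i ∧ i < π.o 0)).card := by
    obtain ⟨l, hl⟩ := hin
    refine Finset.card_pos.2 ⟨π.r l, Finset.mem_filter.2 ⟨π.r_mem_image.2 ?_, hl⟩⟩
    rw [hS]
    refine Finset.mem_erase.2 ⟨?_, Finset.mem_univ _⟩
    rintro rfl
    exact hl.1.false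
  rw [hA, Finset.card_empty, zero_add] at hcard
  have hgκ : Measurable fun u => g 0 u * κ u := (hg 0).mul hκm
  rw [hT, lmarginal_insert _ (π.measurable_weight hg) hb, ← lintegral_const_mul _ hgκ]
  refine lintegral_mono fun y => ?_
  refine (π.lmarginal_weight_le hg h0S h0S (c := 1) _ (fun z _ _ => by simp [← hS]) hΓ).trans ?_
  rw [hA, hcS, Function.update_self, Function.update_of_ne (π.r_ne_o 0 0), sub_zero, mul_one,
    Finset.card_empty, orderedVolume_zero_right, one_mul]
  calc _ ≤ g 0 y * (ind (0 ≤ y ∧ y ≤ t) * (orderedVolume 0 y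
          ((S.image π.r).filter (fun i => π.r 0 < i ∧ i < π.o 0)).card * orderedVolume y t
          ((S.image π.r).filter (fun i => π.r 0 < i ∧ π.o 0 < i)).card * Γ ^ m)) := by
        gcongr
        exact ind_mono fun h => h.2
    _ = Γ ^ m * (g 0 y * (ind (0 ≤ y ∧ y ≤ t) * (orderedVolume 0 y
          ((S.image π.r).filter (fun i => π.r 0 < i ∧ i < π.o 0)).card * orderedVolume y t
          ((S.image π.r).filter (fun i => π.r 0 < i ∧ π.o 0 < i)).card))) := by ring
    _ ≤ _ := by
        gcongr
        exact ind_mul_orderedVolume_le hκ hB hcard y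

/-- The indices other than `0`, if the time `0` is `r l₀` for some `l₀ ≠ 0`. -/
theorem erase_zero_eq {l₀ : Fin (m + 1)} (h0 : π.r l₀ = 0) :
    Finset.univ.erase 0 = insert (π.r 0) (insert (π.o 0)
      (((Finset.univ.erase 0).erase l₀).image π.r ∪ (Finset.univ.erase 0).image π.o)) ∨ l₀ = 0 := by
  by_cases hl : l₀ = 0
  · exact Or.inr hl
  refine Or.inl ?_
  ext i
  simp only [Finset.mem_erase, Finset.mem_univ, and_true, Finset.mem_insert, Finset.mem_union]
  rcases π.exists_eq i with ⟨l, rfl⟩ | ⟨l, rfl⟩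
  · have h1 : π.r l ≠ 0 ↔ l ≠ l₀ := by rw [← h0, π.r_injective.ne_iff]
    have h2 : π.r l = π.r 0 ↔ l = 0 := π.r_injective.eq_iff
    have h3 := π.r_ne_o l 0
    have h4 := π.r_notMem_image (Finset.univ.erase 0) l
    rw [π.r_mem_image, h1, h2]
    simp only [Finset.mem_erase, Finset.mem_univ, and_true]
    constructor
    · intro h; by_cases hl0 : l = 0 <;> tauto
    · rintro (h | h | h | h)
      · rw [h]; exact Ne.symm hl
      · exact absurd h h3
      · exact h.1
      · exact absurd h h4
  · have h1 : π.o l ≠ 0 := by rw [← h0]; exact (π.r_ne_o _ _).symm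
    have h2 : π.o l = π.o 0 ↔ l = 0 := π.o_injective.eq_iff
    rw [π.o_mem_image, h2]
    simp only [Finset.mem_erase, Finset.mem_univ, and_true]
    tauto

include hg hΓ hκm hκ in
/-- The integral of the weight if the time `0` does not belong to the pair of index `0` and some
`r l` lies between `r 0` and `o 0`. -/
theorem lmarginal_weight_le_of_r_eq {l₀ : Fin (m + 1)} (h0 : π.r l₀ = 0) (hl₀ : l₀ ≠ 0)
    (hin : ∃ l, π.r 0 < π.r l ∧ π.r l < π.o 0) :
    (∫⋯∫⁻_Finset.univ.erase 0, π.weight g t ∂fun _ => volume) (fun _ => 0) ≤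
      Γ ^ m * ∫⁻ u, g 0 u * κ u := by
  have hT := (π.erase_zero_eq h0).resolve_right hl₀
  set S : Finset (Fin (m + 1)) := (Finset.univ.erase 0).erase l₀ with hS
  set S' : Finset (Fin (m + 1)) := Finset.univ.erase 0 with hS'
  have h0S : (0 : Fin (m + 1)) ∉ S := by simp [hS, hS']
  have h0S' : (0 : Fin (m + 1)) ∉ S' := Finset.notMem_erase _ _
  have hb : π.o 0 ∉ S.image π.r ∪ S'.image π.o := by
    rw [Finset.mem_union, not_or]
    exact ⟨π.o_notMem_image S 0, fun h => h0S' (π.o_mem_image.1 h)⟩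
  have ha : π.r 0 ∉ insert (π.o 0) (S.image π.r ∪ S'.image π.o) := by
    rw [Finset.mem_insert, Finset.mem_union, not_or, not_or]
    exact ⟨π.r_ne_o 0 0, fun h => h0S (π.r_mem_image.1 h), π.r_notMem_image _ _⟩
  have hcS' : S'.card = m := by rw [hS']; simp
  -- Both `r 0` and `r l₀ = 0` are excluded, so only `m - 1` retained times remain. The missing
  -- power of `t - u` is restored by the sliding of the pair in `lintegral_pair_le`.
  have hcS : S.card + 1 = m := by
    rw [hS, Finset.card_erase_add_one, hcS']
    exact Finset.mem_erase.2 ⟨hl₀, Finset.mem_univ _⟩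
  have hcard := card_filter_add_card_filter_add_card_filter (R := S.image π.r)
    (fun h => h0S (π.r_mem_image.1 h)) (π.o_notMem_image S 0)
  rw [Finset.card_image_of_injective _ π.r_injective] at hcard
  have hB : 1 ≤ ((S.image π.r).filter (fun i => π.r 0 < i ∧ i < π.o 0)).card := by
    obtain ⟨l, hl⟩ := hin
    refine Finset.card_pos.2 ⟨π.r l, Finset.mem_filter.2 ⟨π.r_mem_image.2 ?_, hl⟩⟩
    rw [hS, hS']
    refine Finset.mem_erase.2 ⟨?_, Finset.mem_erase.2 ⟨?_, Finset.mem_univ _⟩⟩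
    -- The witness in the gap cannot be `l₀`, because nothing lies below the index `0`.
    · rintro rfl
      rw [h0] at hl
      exact absurd hl.1 (Fin.not_lt_zero _)
    · rintro rfl
      exact hl.1.false
  set p := ((S.image π.r).filter (· < π.r 0)).card
  set j := ((S.image π.r).filter (fun i => π.r 0 < i ∧ i < π.o 0)).card
  set q := ((S.image π.r).filter (fun i => π.r 0 < i ∧ π.o 0 < i)).card
  have hm := π.measurable_weight hg (t := t)
  rw [hT, lmarginal_insert _ hm ha]
  have hinner : ∀ x, Measurable fun y => g 0 (y - x) * (ind (0 ≤ x ∧ x ≤ y ∧ y ≤ t) *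
        (orderedVolume 0 x p * (orderedVolume x y j * orderedVolume y t q))) := fun x =>
    ((hg 0).comp (measurable_id.sub_const x)).mul
      (((measurable_ind_between t).comp measurable_prodMk_left).mul (by fun_prop))
  calc _ ≤ ∫⁻ x, ∫⁻ y, Γ ^ m * (g 0 (y - x) * (ind (0 ≤ x ∧ x ≤ y ∧ y ≤ t) *
        (orderedVolume 0 x p * (orderedVolume x y j * orderedVolume y t q)))) := by
        refine lintegral_mono fun x => ?_
        rw [lmarginal_insert _ hm hb]
        refine lintegral_mono fun y => ?_
        refine (π.lmarginal_weight_le hg h0S h0S' (c := 1) _ (fun z _ _ => by simp [← hS']) hΓ).trans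
          (le_of_eq ?_)
        rw [Function.update_self, Function.update_of_ne (π.r_ne_o 0 0), Function.update_self, hcS']
        ring
    _ = ∫⁻ x, Γ ^ m * ∫⁻ y, (g 0 (y - x) * (ind (0 ≤ x ∧ x ≤ y ∧ y ≤ t) *
        (orderedVolume 0 x p * (orderedVolume x y j * orderedVolume y t q)))) :=
        lintegral_congr fun x => lintegral_const_mul _ (hinner x)
    _ = Γ ^ m * ∫⁻ x, ∫⁻ y, (g 0 (y - x) * (ind (0 ≤ x ∧ x ≤ y ∧ y ≤ t) *
        (orderedVolume 0 x p * (orderedVolume x y j * orderedVolume y t q)))) := by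
        refine lintegral_const_mul _ (Measurable.lintegral_prod_right ?_)
        exact ((hg 0).comp (measurable_snd.sub measurable_fst)).mul
          ((measurable_ind_between t).mul (by fun_prop))
    _ ≤ _ := by
        refine mul_le_mul_right ((lintegral_pair_le (hg 0) t p j q).trans ?_) _
        refine lintegral_mono fun u => ?_
        simp only
        gcongr
        exact ind_mul_orderedVolume_le hκ hB (by omega) u

include hg hΓ hκm hκ in
/-- The integral of the weight if the partner of the time `0` is the only time between those of
index `r 0` and `o 0`. -/
theorem lmarginal_weight_le_of_o_between {l₀ : Fin (m + 1)} (h0 : π.r l₀ = 0)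
    (hl₀ : l₀ ≠ 0) (hin : π.r 0 < π.o l₀ ∧ π.o l₀ < π.o 0)
    (hno : ¬∃ l, π.r 0 < π.r l ∧ π.r l < π.o 0) :
    (∫⋯∫⁻_Finset.univ.erase 0, π.weight g t ∂fun _ => volume) (fun _ => 0) ≤
      Γ ^ m * ∫⁻ u, g 0 u * κ u := by
  have hT := (π.erase_zero_eq h0).resolve_right hl₀
  set S : Finset (Fin (m + 1)) := (Finset.univ.erase 0).erase l₀ with hS
  have h0S : (0 : Fin (m + 1)) ∉ S := by simp [hS]
  have hlS : l₀ ∉ S := by simp [hS]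
  have hins : Finset.univ.erase (0 : Fin (m + 1)) = insert l₀ S := by
    rw [hS, Finset.insert_erase]
    exact Finset.mem_erase.2 ⟨hl₀, Finset.mem_univ _⟩
  rw [hins, Finset.image_insert, Finset.union_insert, Finset.insert_comm (π.o 0),
    Finset.insert_comm (π.r 0)] at hT
  have hb : π.o 0 ∉ S.image π.r ∪ S.image π.o := by
    rw [Finset.mem_union, not_or]
    exact ⟨π.o_notMem_image S 0, fun h => h0S (π.o_mem_image.1 h)⟩
  have ha : π.r 0 ∉ insert (π.o 0) (S.image π.r ∪ S.image π.o) := by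
    rw [Finset.mem_insert, Finset.mem_union, not_or, not_or]
    exact ⟨π.r_ne_o 0 0, fun h => h0S (π.r_mem_image.1 h), π.r_notMem_image _ _⟩
  have hc' : π.o l₀ ∉ S.image π.r ∪ S.image π.o := by
    rw [Finset.mem_union, not_or]
    exact ⟨π.o_notMem_image S _, fun h => hlS (π.o_mem_image.1 h)⟩
  have hca : π.o l₀ ≠ π.r 0 := (π.r_ne_o _ _).symm
  have hcb : π.o l₀ ≠ π.o 0 := π.o_injective.ne hl₀
  have hc : π.o l₀ ∉ insert (π.r 0) (insert (π.o 0) (S.image π.r ∪ S.image π.o)) := by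
    rw [Finset.mem_insert, Finset.mem_insert, not_or, not_or]
    exact ⟨hca, hcb, hc'⟩
  have h0I : (0 : Fin (2 * m + 2)) ∉ S.image π.r ∪ S.image π.o := by
    rw [← h0, Finset.mem_union, not_or]
    exact ⟨fun h => hlS (π.r_mem_image.1 h), π.r_notMem_image _ _⟩
  have hcS : S.card + 1 = m := by
    rw [hS, Finset.card_erase_add_one]
    · simp
    · exact Finset.mem_erase.2 ⟨hl₀, Finset.mem_univ _⟩
  have hcard := card_filter_add_card_filter_add_card_filter (R := S.image π.r)
    (fun h => h0S (π.r_mem_image.1 h)) (π.o_notMem_image S 0)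
  rw [Finset.card_image_of_injective _ π.r_injective] at hcard
  have hB : (S.image π.r).filter (fun i => π.r 0 < i ∧ i < π.o 0) = ∅ := by
    refine Finset.filter_false_of_mem fun i hi h => hno ?_
    obtain ⟨l, -, rfl⟩ := Finset.mem_image.1 hi
    exact ⟨l, h⟩
  rw [hB, Finset.card_empty, zero_add] at hcard
  have hbd := fun (c : ℝ≥0∞) x hc => π.lmarginal_weight_le hg (t := t) h0S h0S (c := c) x hc hΓ
  rw [hB, Finset.card_empty] at hbd
  set p := ((S.image π.r).filter (· < π.r 0)).card
  set q := ((S.image π.r).filter (fun i => π.r 0 < i ∧ π.o 0 < i)).card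
  have hm := π.measurable_weight hg (t := t)
  have hg0 : Measurable fun v => Γ ^ S.card * g l₀ v := (hg l₀).const_mul _
  rw [hT, lmarginal_insert _ hm hc]
  -- The time `v` of index `o l₀` is integrated last: its partner is the time `0`, so its pair
  -- function is `g l₀ v`, free of `x` and `y`.
  calc _ ≤ ∫⁻ v, ∫⁻ x, ∫⁻ y, (Γ ^ S.card * g l₀ v) * (g 0 (y - x) * (ind (x ≤ v ∧ v ≤ y) *
        (ind (0 ≤ x ∧ x ≤ y ∧ y ≤ t) *
        (orderedVolume 0 x p * (orderedVolume x y 0 * orderedVolume y t q))))) := by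
        refine lintegral_mono fun v => ?_
        rw [lmarginal_insert _ hm ha]
        refine lintegral_mono fun x => ?_
        rw [lmarginal_insert _ hm hb]
        refine lintegral_mono fun y => ?_
        -- The constant keeps the constraint `x ≤ v ≤ y`, which holds by monotonicity on the
        -- simplex; it is the only trace of the gap in this case.
        refine (hbd (g l₀ v * ind (x ≤ v ∧ v ≤ y)) _ fun z hz hzx => ?_).trans (le_of_eq ?_)
        · have hmono : Monotone z := by simpa [MonotoneOn, Monotone] using hz.1
          have hza : z (π.r 0) = x := by
            rw [hzx _ fun h => ha (Finset.mem_insert_of_mem h),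
              Function.update_of_ne (π.r_ne_o 0 0), Function.update_self]
          have hzb : z (π.o 0) = y := by rw [hzx _ hb, Function.update_self]
          have hzc : z (π.o l₀) = v := by
            rw [hzx _ hc', Function.update_of_ne hcb, Function.update_of_ne hca,
              Function.update_self]
          have hz0 : z 0 = 0 := by
            have h1 : (0 : Fin (2 * m + 2)) ≠ π.o 0 := h0 ▸ π.r_ne_o _ _
            have h2 : (0 : Fin (2 * m + 2)) ≠ π.r 0 := h0 ▸ π.r_injective.ne hl₀
            have h3 : (0 : Fin (2 * m + 2)) ≠ π.o l₀ := h0 ▸ π.r_ne_o _ _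
            rw [hzx _ h0I, Function.update_of_ne h1, Function.update_of_ne h2,
              Function.update_of_ne h3]
          have hsd : Finset.univ.erase 0 \ S = {l₀} := by
            rw [hins, Finset.insert_sdiff_of_notMem _ hlS, Finset.sdiff_self]
            rfl
          rw [hsd, Finset.prod_singleton, hzc, h0, hz0, sub_zero, ind_of_true, mul_one]
          rw [← hza, ← hzb, ← hzc]
          exact ⟨hmono hin.1.le, hmono hin.2.le⟩
        · rw [Function.update_self, Function.update_of_ne (π.r_ne_o 0 0), Function.update_self]
          ring
    _ = ∫⁻ v, (Γ ^ S.card * g l₀ v) * ∫⁻ x, ∫⁻ y, g 0 (y - x) * (ind (x ≤ v ∧ v ≤ y) *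
        (ind (0 ≤ x ∧ x ≤ y ∧ y ≤ t) *
        (orderedVolume 0 x p * (orderedVolume x y 0 * orderedVolume y t q)))) := by
        refine lintegral_congr fun v => ?_
        have hv := measurable_pair_through (hg 0) t v p q
        rw [← lintegral_const_mul _ hv.lintegral_prod_right]
        exact lintegral_congr fun x => lintegral_const_mul _ hv.of_uncurry_left
    _ ≤ ∫⁻ v, (Γ ^ S.card * g l₀ v) * ∫⁻ u, g 0 u * κ u := by
        refine lintegral_mono fun v => mul_le_mul_right ?_ _
        refine (lintegral_pair_through_le (hg 0) t v p q).trans ?_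
        refine lintegral_mono fun u => ?_
        simp only
        gcongr
        -- Here `j = 1` and `p + q = m - 1`.
        exact ind_mul_orderedVolume_le hκ le_rfl (by omega) u
    _ = _ := by
        rw [lintegral_mul_const _ hg0, lintegral_const_mul _ (hg l₀), hΓ, ← pow_succ, hcS]

-- The three positions of the time `0` are combined: it belongs to the distinguished pair, it
-- belongs to another pair while a retained time lies in the gap, or its partner is the time in the
-- gap.
include hg hΓ hκm hκ in
theorem lmarginal_weight_le_of_exists (h0 : ∃ l, π.r l = 0)
    (hin : ∃ l, π.r 0 < π.r l ∧ π.r l < π.o 0 ∨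
      π.r l = 0 ∧ π.r 0 < π.o l ∧ π.o l < π.o 0) :
    (∫⋯∫⁻_Finset.univ.erase 0, π.weight g t ∂fun _ => volume) (fun _ => 0) ≤
      Γ ^ m * ∫⁻ u, g 0 u * κ u := by
  obtain ⟨l₀, h0⟩ := h0
  by_cases hex : ∃ l, π.r 0 < π.r l ∧ π.r l < π.o 0
  · rcases eq_or_ne l₀ 0 with rfl | hl₀
    · exact π.lmarginal_weight_le_of_r_zero_eq hg hΓ hκm hκ h0 hex
    · exact π.lmarginal_weight_le_of_r_eq hg hΓ hκm hκ h0 hl₀ hex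
  · obtain ⟨l, h | h⟩ := hin
    · exact absurd ⟨l, h⟩ hex
    · refine π.lmarginal_weight_le_of_o_between hg hΓ hκm hκ h.1 ?_ h.2 hex
      rintro rfl
      exact h.2.2.false

end Pairing

end Pairings

/-! ### From gapped permutations to the bound -/

section Final

open MeasureTheory ENNReal

/-- The pairing defined by a gapped permutation, oriented such that the time `0` and, if possible,
a time inside the gap are of the form `r l`. The pairs in `s` are those with `r l = p (2l+1)`. -/
theorem exists_pairing {m : ℕ} {p : Equiv.Perm (Fin (2 * m + 2))} (hp : p ∈ gappedPerms m) :
    ∃ (π : Pairing m) (s : Set (Fin (m + 1))),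
      (∀ l ∈ s, π.r l = p ⟨2 * l + 1, by omega⟩ ∧ π.o l = p ⟨2 * l, by omega⟩) ∧
      (∀ l ∉ s, π.r l = p ⟨2 * l, by omega⟩ ∧ π.o l = p ⟨2 * l + 1, by omega⟩) ∧
      (∃ l, π.r l = 0) ∧ ∃ l, π.r 0 < π.r l ∧ π.r l < π.o 0 ∨
        π.r l = 0 ∧ π.r 0 < π.o l ∧ π.o l < π.o 0 := by
  classical
  let ev : Fin (m + 1) → Fin (2 * m + 2) := fun l => p ⟨2 * l, by omega⟩
  let od : Fin (m + 1) → Fin (2 * m + 2) := fun l => p ⟨2 * l + 1, by omega⟩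
  have hee : ∀ l l', ev l = ev l' → l = l' := fun l l' h => by
    have := p.injective h
    simp only [Fin.mk.injEq] at this
    ext; omega
  have hoo : ∀ l l', od l = od l' → l = l' := fun l l' h => by
    have := p.injective h
    simp only [Fin.mk.injEq] at this
    ext; omega
  have heo : ∀ l l', ev l ≠ od l' := fun l l' h => by
    have := p.injective h
    simp only [Fin.mk.injEq] at this
    omega
  have hcov : ∀ i, ∃ l, i = ev l ∨ i = od l := by
    intro i
    obtain ⟨⟨k, hk⟩, rfl⟩ := p.surjective i
    refine ⟨⟨k / 2, by omega⟩, ?_⟩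
    rcases Nat.even_or_odd' k with ⟨c, rfl | rfl⟩
    · left; congr 1; ext; simp
    · right; congr 1; ext; simp only []; omega
  have hgap : (ev 0 : ℕ) + 2 ≤ od 0 ∨ (od 0 : ℕ) + 2 ≤ ev 0 := by
    have h := (Finset.mem_filter.1 hp).2
    rw [le_abs] at h
    have h1 : (p ⟨1, by omega⟩ : ℕ) = od 0 := rfl
    have h2 : (p ⟨0, by omega⟩ : ℕ) = ev 0 := rfl
    rw [h1, h2] at h
    omega
  have hq : min (ev 0 : ℕ) (od 0) + 1 < 2 * m + 2 := by omega
  -- The successor of the smaller index of the first pair; the gap condition places it strictly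
  -- inside that pair.
  let q : Fin (2 * m + 2) := ⟨min (ev 0 : ℕ) (od 0) + 1, hq⟩
  have hqv : (q : ℕ) = min (ev 0 : ℕ) (od 0) + 1 := rfl
  have hq0 : q ≠ 0 := fun h => by
    have := congrArg Fin.val h
    rw [hqv] at this
    simp at this
  -- The first pair is oriented increasingly. In every other pair `0` is retained, and `q` is
  -- retained unless its partner is `0`: the requirement on `0` takes precedence.
  let s : Set (Fin (m + 1)) :=
    {l | (l = 0 ∧ od 0 < ev 0) ∨ (l ≠ 0 ∧ (od l = 0 ∨ (od l = q ∧ ev l ≠ 0)))}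
  let r : Fin (m + 1) → Fin (2 * m + 2) := fun l => if l ∈ s then od l else ev l
  let o : Fin (m + 1) → Fin (2 * m + 2) := fun l => if l ∈ s then ev l else od l
  have hr1 : ∀ l ∈ s, r l = od l := fun l hl => if_pos hl
  have hr2 : ∀ l ∉ s, r l = ev l := fun l hl => if_neg hl
  have ho1 : ∀ l ∈ s, o l = ev l := fun l hl => if_pos hl
  have ho2 : ∀ l ∉ s, o l = od l := fun l hl => if_neg hl
  have hbij : Function.Bijective (Sum.elim r o) := by
    rw [Fintype.bijective_iff_injective_and_card]
    refine ⟨?_, by simp; ring⟩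
    rintro (l | l) (l' | l') h <;> simp only [Sum.elim_inl, Sum.elim_inr] at h <;>
      by_cases hl : l ∈ s <;> by_cases hl' : l' ∈ s <;>
      simp only [hr1, hr2, ho1, ho2, hl, hl', not_false_eq_true] at h <;>
      first
        | exact absurd h (heo _ _)
        | exact absurd h.symm (heo _ _)
        | (obtain rfl := hee _ _ h; first | rfl | exact absurd hl hl' | exact absurd hl' hl)
        | (obtain rfl := hoo _ _ h; first | rfl | exact absurd hl hl' | exact absurd hl' hl)
  have h0s : (0 : Fin (m + 1)) ∈ s ↔ od 0 < ev 0 := by simp [s]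
  have hab : (r 0 : ℕ) + 2 ≤ o 0 ∧ (q : ℕ) = r 0 + 1 := by
    by_cases h : od 0 < ev 0
    · rw [hr1 _ (h0s.2 h), ho1 _ (h0s.2 h), hqv]
      rw [Fin.lt_def] at h
      omega
    · rw [hr2 _ (fun hs => h (h0s.1 hs)), ho2 _ (fun hs => h (h0s.1 hs)), hqv]
      rw [Fin.lt_def] at h
      omega
  have hqr : r 0 < q := Fin.lt_def.2 (by omega)
  have hqo : q < o 0 := Fin.lt_def.2 (by omega)
  have hns : ∀ l ≠ 0, l ∈ s ↔ (od l = 0 ∨ (od l = q ∧ ev l ≠ 0)) := fun l hl => by simp [s, hl]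
  refine ⟨⟨r, o, hbij, Fin.lt_def.2 (by omega)⟩, s, fun l hl => ⟨hr1 l hl, ho1 l hl⟩,
    fun l hl => ⟨hr2 l hl, ho2 l hl⟩, ?_, ?_⟩
  · change ∃ l, r l = 0
    obtain ⟨l, hl⟩ := hcov 0
    refine ⟨l, ?_⟩
    rcases eq_or_ne l 0 with rfl | hl0
    · have h1 : (0 : ℕ) = ev 0 ∨ (0 : ℕ) = od 0 := hl.imp (congrArg Fin.val) (congrArg Fin.val)
      by_cases h : od 0 < ev 0
      · rw [hr1 _ (h0s.2 h)]
        rw [Fin.lt_def] at h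
        exact Fin.ext (show (od 0 : ℕ) = 0 by omega)
      · rw [hr2 _ (fun hs => h (h0s.1 hs))]
        rw [Fin.lt_def] at h
        exact Fin.ext (show (ev 0 : ℕ) = 0 by omega)
    · rcases hl with hl | hl
      · rw [hr2 l, ← hl]
        rw [hns l hl0]
        rintro (h | h)
        · exact heo l l (hl.symm.trans h.symm)
        · exact h.2 hl.symm
      · rw [hr1 l ((hns l hl0).2 (Or.inl hl.symm)), ← hl]
  · change ∃ l, r 0 < r l ∧ r l < o 0 ∨ r l = 0 ∧ r 0 < o l ∧ o l < o 0
    obtain ⟨l, hl⟩ := hcov q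
    have hl0 : l ≠ 0 := by
      rintro rfl
      have h1 : (q : ℕ) = ev 0 ∨ (q : ℕ) = od 0 := hl.imp (congrArg Fin.val) (congrArg Fin.val)
      omega
    refine ⟨l, ?_⟩
    rcases hl with hl | hl
    · by_cases h : od l = 0
      · have hs : l ∈ s := (hns l hl0).2 (Or.inl h)
        rw [hr1 l hs, ho1 l hs, ← hl]
        exact Or.inr ⟨h, hqr, hqo⟩
      · have hs : l ∉ s := by
          rw [hns l hl0]
          rintro (h' | h')
          · exact h h'
          · exact heo l l (hl.symm.trans h'.1.symm)
        rw [hr2 l hs, ← hl]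
        exact Or.inl ⟨hqr, hqo⟩
    · by_cases h : ev l = 0
      · have hs : l ∉ s := by
          rw [hns l hl0]
          rintro (h' | h')
          · exact hq0 (hl.trans h')
          · exact h'.2 h
        rw [hr2 l hs, ho2 l hs, ← hl]
        exact Or.inr ⟨h, hqr, hqo⟩
      · have hs : l ∈ s := (hns l hl0).2 (Or.inr ⟨hl.symm, h⟩)
        rw [hr1 l hs, ← hl]
        exact Or.inl ⟨hqr, hqo⟩

theorem measurableSet_simplex (n : ℕ) (t : ℝ) : MeasurableSet (simplex n t) := by
  have h : simplex n t = {z | z ∈ orderedSet Finset.univ 0 t} := by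
    ext z
    simp [simplex, orderedSet, monotoneOn_univ]
  rw [h]
  exact measurableSet_orderedSet _ measurable_const measurable_const measurable_id

theorem times_mem_orderedSet {n : ℕ} {t : ℝ} (ht : 0 < t) {z : Fin (n + 1) → ℝ}
    (hz : z ∈ simplex (n + 1) t) : times z ∈ orderedSet Finset.univ 0 t := by
  refine ⟨?_, fun i _ => ?_⟩
  · rintro i - j - hij
    induction i using Fin.cases with
    | zero =>
      induction j using Fin.cases with
      | zero => exact le_rfl
      | succ j => simpa [times] using (hz.2 j).1
    | succ i =>
      induction j using Fin.cases with
      | zero => exact absurd hij (by simp)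
      | succ j => simpa [times] using hz.1 (Fin.succ_le_succ_iff.1 hij)
  · induction i using Fin.cases with
    | zero => simp [times, ht.le]
    | succ i => simpa [times] using hz.2 i

theorem lintegral_times_le {n : ℕ} {F : (Fin (n + 2) → ℝ) → ℝ≥0∞} (hF : Measurable F) :
    ∫⁻ z : Fin (n + 1) → ℝ, F (times z) ≤
      (∫⋯∫⁻_Finset.univ.erase 0, F ∂fun _ => volume) (fun _ => 0) := by
  have ht : Measurable fun z : Fin (n + 1) → ℝ => F (times z) := by
    refine hF.comp (measurable_pi_iff.2 fun i => ?_)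
    induction i using Fin.cases with
    | zero => simp [times]
    | succ i => simpa [times] using measurable_pi_apply i
  have h1 := lmarginal_image (X := fun _ : Fin (n + 2) => ℝ) (μ := fun _ => volume)
    (Fin.succ_injective (n + 1)) Finset.univ ht (fun _ => 0)
  rw [← lintegral_eq_lmarginal_univ] at h1
  have h2 : Finset.univ.erase (0 : Fin (n + 2)) = Finset.univ.image Fin.succ := by
    ext i
    simp
  rw [h2]
  refine h1.symm.trans_le (lmarginal_mono_of_eqOn fun z hz => le_of_eq ?_)
  have h0 : z 0 = 0 := hz 0 (by simp)
  change F (Fin.cons 0 fun i => z (Fin.succ i)) = F z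
  congr 1
  rw [← h0]
  exact Fin.cons_self_tail z

/-- Integrability makes `f` only almost everywhere measurable. A measurable majorant that dominates
at every point, not merely almost everywhere, bounds products of values `f (z i - z j)` without any
discussion of null sets, and has the same integrals. It is `⊤` on a measurable null set. -/
theorem exists_measurable_ge {X : Type*} [MeasurableSpace X] {μ : Measure X} {F : X → ℝ≥0∞}
    (hF : AEMeasurable F μ) : ∃ G, Measurable G ∧ F ≤ G ∧ G =ᵐ[μ] F := by
  classical
  have hnull : μ {x | F x ≠ hF.mk F x} = 0 := ae_iff.1 hF.ae_eq_mk
  refine ⟨(toMeasurable μ {x | F x ≠ hF.mk F x}).piecewise (fun _ => ⊤) (hF.mk F),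
    measurable_const.piecewise (measurableSet_toMeasurable _ _) hF.measurable_mk, fun x => ?_, ?_⟩
  · by_cases hx : x ∈ toMeasurable μ {x | F x ≠ hF.mk F x}
    · rw [Set.piecewise_eq_of_mem _ _ _ hx]; exact le_top
    · rw [Set.piecewise_eq_of_notMem _ _ _ hx]
      by_contra hne
      exact hx (subset_toMeasurable _ _ fun h => hne h.le)
  · rw [← measure_toMeasurable] at hnull
    filter_upwards [hF.ae_eq_mk, measure_eq_zero_iff_ae_notMem.1 hnull] with x hx hx'
    rw [Set.piecewise_eq_of_notMem _ _ _ hx', hx]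

theorem lintegral_simplex_gappedPerm_le {m : ℕ} {ε t : ℝ} (hε : 0 < ε) (hε1 : ε < 1)
    (ht : 0 < t) {G : ℝ → ℝ≥0∞} (hG : Measurable G) {p : Equiv.Perm (Fin (2 * m + 2))}
    (hp : p ∈ gappedPerms m) :
    ∫⁻ z in simplex (2 * m + 1) t, ∏ l : Fin (m + 1),
        G (times z (p ⟨2 * l, by omega⟩) - times z (p ⟨2 * l + 1, by omega⟩)) ≤
      (∫⁻ s, G s) ^ m * ((∫⁻ s, G s * ENNReal.ofReal ((1 + |s|) ^ ε)) *
        ENNReal.ofReal (t ^ ((m : ℝ) - ε) * ξ m ε)) := by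
  classical
  obtain ⟨π, s, hs1, hs2, h0, hin⟩ := exists_pairing hp
  -- `G` need not be even, so its argument is reflected for the pairs whose difference `z (o l) - z
  -- (r l)` has the opposite sign. The integrals are unaffected because the weight is even.
  let g : Fin (m + 1) → ℝ → ℝ≥0∞ := fun l u => if l ∈ s then G u else G (-u)
  have hg : ∀ l, Measurable (g l) := fun l => by
    by_cases hl : l ∈ s
    · simpa only [g, hl, if_true] using hG
    · simp only [g, hl, if_false]
      exact hG.comp measurable_neg
  have hgl : ∀ l (h : ℝ → ℝ≥0∞), (∀ u, h (-u) = h u) → ∫⁻ u, g l u * h u = ∫⁻ u, G u * h u := by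
    intro l h hh
    by_cases hl : l ∈ s
    · simp only [g, hl, if_true]
    · simp only [g, hl, if_false]
      rw [← lintegral_neg_eq_self]
      simp only [neg_neg, hh]
  have hΓ : ∀ l, ∫⁻ u, g l u = ∫⁻ u, G u := fun l => by simpa using hgl l 1 (fun _ => rfl)
  let κ : ℝ → ℝ≥0∞ := fun u => ENNReal.ofReal ((1 + |u|) ^ ε) *
    ENNReal.ofReal (t ^ ((m : ℝ) - ε) * ξ m ε)
  have hw : Measurable fun u : ℝ => ENNReal.ofReal ((1 + |u|) ^ ε) := by fun_prop
  have hκm : Measurable κ := hw.mul_const _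
  have hκ : ∀ j u, 1 ≤ j → j ≤ m → 0 ≤ u → u ≤ t →
      orderedVolume 0 u j * orderedVolume u t (m - j) ≤ κ u := by
    intro j u hj hjm hu hut
    have htu : 0 ≤ t - u := sub_nonneg.2 hut
    unfold orderedVolume
    simp only [κ]
    rw [← ENNReal.ofReal_mul (by rw [sub_zero]; positivity), ← ENNReal.ofReal_mul (by positivity),
      sub_zero]
    exact ENNReal.ofReal_le_ofReal (pow_mul_pow_le_ξ hε hε1 hj hjm hu hut ht)
  have hmain := π.lmarginal_weight_le_of_exists hg hΓ hκm hκ h0 hin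
  have hint : ∫⁻ u, g 0 u * κ u = (∫⁻ u, G u * ENNReal.ofReal ((1 + |u|) ^ ε)) *
      ENNReal.ofReal (t ^ ((m : ℝ) - ε) * ξ m ε) := by
    have hGw : Measurable fun u => G u * ENNReal.ofReal ((1 + |u|) ^ ε) := hG.mul hw
    rw [hgl 0 κ fun u => by simp [κ], ← lintegral_mul_const _ hGw]
    exact lintegral_congr fun u => by simp only [κ]; ring
  rw [hint] at hmain
  refine le_trans ?_ ((lintegral_times_le (π.measurable_weight hg)).trans hmain)
  rw [← lintegral_indicator (measurableSet_simplex _ _)]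
  refine lintegral_mono fun z => ?_
  by_cases hz : z ∈ simplex (2 * m + 1) t
  · rw [Set.indicator_of_mem hz, Pairing.weight, ind_of_true (times_mem_orderedSet ht hz), one_mul]
    refine Finset.prod_le_prod' fun l _ => le_of_eq ?_
    by_cases hl : l ∈ s
    · simp only [g, hl, if_true]
      rw [(hs1 l hl).1, (hs1 l hl).2]
    · simp only [g, hl, if_false]
      rw [(hs2 l hl).1, (hs2 l hl).2, neg_sub]
  · rw [Set.indicator_of_notMem hz]
    exact zero_le

theorem card_gappedPerms_le (m : ℕ) : (gappedPerms m).card ≤ (2 * m + 2).factorial := by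
  refine (Finset.card_le_univ _).trans_eq ?_
  rw [Fintype.card_perm, Fintype.card_fin]

namespace Clustering

variable {HS HR : Type*} [NormedAddCommGroup HS] [InnerProductSpace ℂ HS]
  [FiniteDimensional ℂ HS] [NormedAddCommGroup HR] [InnerProductSpace ℂ HR] [CompleteSpace HR]
  {M : Model HS HR} {f : ℝ → ℝ} {ε C : ℝ} (h : Clustering M f ε C)

include h

theorem one_le_weight (s : ℝ) : 1 ≤ (1 + |s|) ^ ε :=
  Real.one_le_rpow (by linarith [abs_nonneg s]) h.ε_pos.le

/-- `f` is the integrable function `f(s) (1 + |s|)^ε` divided by its continuous positive weight. -/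
theorem aestronglyMeasurable : AEStronglyMeasurable f volume := by
  have hw : Measurable fun s : ℝ => ((1 + |s|) ^ ε)⁻¹ := by fun_prop
  refine (h.integrable.aestronglyMeasurable.mul hw.aestronglyMeasurable).congr
    (Filter.Eventually.of_forall fun s => ?_)
  have := h.one_le_weight s
  simp only [Pi.mul_apply]
  field_simp

theorem integrable_self : Integrable f := by
  refine h.integrable.mono' h.aestronglyMeasurable (Filter.Eventually.of_forall fun s => ?_)
  rw [Real.norm_of_nonneg (h.nonneg s)]
  exact le_mul_of_one_le_right (h.nonneg s) (h.one_le_weight s)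

theorem norm_integrand_le {m : ℕ} (hm : 1 ≤ m) {t : ℝ} {z : Fin (2 * m + 1) → ℝ}
    (hz : z ∈ simplex (2 * m + 1) t) :
    ‖M.integrand (2 * m) z‖ ≤ (2 * C * ‖M.W‖) ^ (2 * m + 2) / (m.factorial : ℝ) *
        ∑ p ∈ gappedPerms m, ∏ l : Fin (m + 1),
          f (times z (p ⟨2 * l, by omega⟩) - times z (p ⟨2 * l + 1, by omega⟩)) := by
  refine (M.norm_integrand_le (2 * m) z fun A =>
    h.bound m hm A z hz.1 fun i => (hz.2 i).1).trans_eq ?_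
  rw [mul_pow, mul_pow, mul_pow]
  ring

theorem lintegral_enorm_integrand_le {m : ℕ} (hm : 1 ≤ m) {t : ℝ} (ht : 0 < t) :
    ∫⁻ z in simplex (2 * m + 1) t, ‖M.integrand (2 * m) z‖ₑ ≤
      ENNReal.ofReal (boundConst m C ‖M.W‖ f ε * t ^ ((m : ℝ) - ε)) := by
  obtain ⟨G, hGm, hfG, hGf⟩ := exists_measurable_ge
    (h.aestronglyMeasurable.aemeasurable.ennreal_ofReal)
  have hC := h.C_pos
  have hξ := ξ_nonneg hm h.ε_lt_one
  have hf0 : 0 ≤ ∫ s, f s := integral_nonneg h.nonneg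
  have hw0 : 0 ≤ weightedNorm f ε := integral_nonneg fun s =>
    mul_nonneg (h.nonneg s) (zero_le_one.trans (h.one_le_weight s))
  have hΓ : ∫⁻ s, G s = ENNReal.ofReal (∫ s, f s) := by
    rw [lintegral_congr_ae hGf, ofReal_integral_eq_lintegral_ofReal h.integrable_self
      (Filter.Eventually.of_forall h.nonneg)]
  have hΓw : ∫⁻ s, G s * ENNReal.ofReal ((1 + |s|) ^ ε) = ENNReal.ofReal (weightedNorm f ε) := by
    rw [weightedNorm, ofReal_integral_eq_lintegral_ofReal h.integrable
      (Filter.Eventually.of_forall fun s =>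
        mul_nonneg (h.nonneg s) (zero_le_one.trans (h.one_le_weight s)))]
    refine lintegral_congr_ae (hGf.mono fun s hs => ?_)
    simp only [hs]
    rw [ENNReal.ofReal_mul (h.nonneg s)]
  set c := (2 * C * ‖M.W‖) ^ (2 * m + 2) / (m.factorial : ℝ) with hc
  have hc0 : 0 ≤ c := by positivity
  have hmeas : ∀ p : Equiv.Perm (Fin (2 * m + 2)), Measurable fun z : Fin (2 * m + 1) → ℝ =>
      ∏ l : Fin (m + 1),
        G (times z (p ⟨2 * l, by omega⟩) - times z (p ⟨2 * l + 1, by omega⟩)) := by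
    intro p
    have ht : ∀ i, Measurable fun z : Fin (2 * m + 1) → ℝ => times z i := by
      intro i
      induction i using Fin.cases with
      | zero => simp [times]
      | succ i => simpa [times] using measurable_pi_apply i
    exact Finset.measurable_prod _ fun l _ => hGm.comp ((ht _).sub (ht _))
  calc _ ≤ ∫⁻ z in simplex (2 * m + 1) t, ENNReal.ofReal c * ∑ p ∈ gappedPerms m,
        ∏ l : Fin (m + 1),
          G (times z (p ⟨2 * l, by omega⟩) - times z (p ⟨2 * l + 1, by omega⟩)) := by
        refine setLIntegral_mono' (measurableSet_simplex _ _) fun z hz => ?_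
        rw [← ofReal_norm]
        refine (ENNReal.ofReal_le_ofReal (h.norm_integrand_le hm hz)).trans ?_
        rw [ENNReal.ofReal_mul hc0, ENNReal.ofReal_sum_of_nonneg fun p _ =>
          Finset.prod_nonneg fun l _ => h.nonneg _]
        gcongr with p hp
        rw [ENNReal.ofReal_prod_of_nonneg fun l _ => h.nonneg _]
        exact Finset.prod_le_prod' fun l _ => hfG _
    _ = ENNReal.ofReal c * ∑ p ∈ gappedPerms m, ∫⁻ z in simplex (2 * m + 1) t,
        ∏ l : Fin (m + 1),
          G (times z (p ⟨2 * l, by omega⟩) - times z (p ⟨2 * l + 1, by omega⟩)) := by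
        rw [lintegral_const_mul _ (Finset.measurable_fun_sum _ fun p _ => hmeas p),
          lintegral_finsetSum _ fun p _ => hmeas p]
    _ ≤ ENNReal.ofReal c * ∑ p ∈ gappedPerms m, (ENNReal.ofReal (∫ s, f s)) ^ m *
        (ENNReal.ofReal (weightedNorm f ε) * ENNReal.ofReal (t ^ ((m : ℝ) - ε) * ξ m ε)) := by
        gcongr with p hp
        rw [← hΓ, ← hΓw]
        exact lintegral_simplex_gappedPerm_le h.ε_pos h.ε_lt_one ht hGm hp
    _ ≤ ENNReal.ofReal c * (ENNReal.ofReal ((2 * m + 2).factorial : ℝ) *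
        ((ENNReal.ofReal (∫ s, f s)) ^ m *
        (ENNReal.ofReal (weightedNorm f ε) * ENNReal.ofReal (t ^ ((m : ℝ) - ε) * ξ m ε)))) := by
        rw [Finset.sum_const, nsmul_eq_mul, ENNReal.ofReal_natCast]
        gcongr
        exact card_gappedPerms_le m
    _ = _ := by
        rw [← ENNReal.ofReal_pow hf0, ← ENNReal.ofReal_mul hw0, ← ENNReal.ofReal_mul (by positivity),
          ← ENNReal.ofReal_mul (by positivity), ← ENNReal.ofReal_mul hc0, boundConst]
        congr 1
        ring

end Clustering

end Final

end OpenSystem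

end

theorem mainTheorem4 {HS HR : Type*} [NormedAddCommGroup HS] [InnerProductSpace ℂ HS]
    [FiniteDimensional ℂ HS] [NormedAddCommGroup HR] [InnerProductSpace ℂ HR] [CompleteSpace HR]
    [TopologicalSpace.SeparableSpace HR] (M : OpenSystem.Model HS HR)
    (hφ : MeasureTheory.Integrable M.φ)
    (f : ℝ → ℝ) (ε C : ℝ) (hM : OpenSystem.Clustering M f ε C)
    (m : ℕ) (hm : 1 ≤ m) (t : ℝ) (ht : 0 < t) :
    MeasureTheory.IntegrableOn (M.integrand (2 * m)) (OpenSystem.simplex (2 * m + 1) t) ∧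
      ‖M.K (2 * m) t‖ ≤ OpenSystem.boundConst m C ‖M.W‖ f ε * t ^ ((m : ℝ) - ε) := by
  refine ⟨M.integrableOn_integrand _ _, ?_⟩
  have hξ := OpenSystem.ξ_nonneg hm hM.ε_lt_one
  have hf0 : 0 ≤ ∫ s, f s := MeasureTheory.integral_nonneg hM.nonneg
  have hw0 : 0 ≤ OpenSystem.weightedNorm f ε := MeasureTheory.integral_nonneg fun s =>
    mul_nonneg (hM.nonneg s) (zero_le_one.trans (hM.one_le_weight s))
  have hC := hM.C_pos
  have hnn : 0 ≤ OpenSystem.boundConst m C ‖M.W‖ f ε * t ^ ((m : ℝ) - ε) := by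
    unfold OpenSystem.boundConst
    positivity
  rw [← ENNReal.ofReal_le_ofReal_iff hnn, ofReal_norm]
  exact (MeasureTheory.enorm_integral_le_lintegral_enorm _).trans
    (hM.lintegral_enorm_integrand_le hm ht)
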